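/- Let $R$ be a normal Gorenstein domain: a Noetherian integrally closed domain such that $R_{\mathfrak m}$ has finite injective dimension as a module over itself for every maximal ideal $\mathfrak m$. Let $M$ be a reflexive $R$-module (the canonical map $M\to M^{**}$, with $(-)^*=\operatorname{Hom}_R(-,R)$, is an isomorphism), and put $A=\operatorname{End}_R(M)$. Suppose that $\operatorname{gl\,dim}A<\infty$ and that $A$ is a maximal Cohen–Macaulay $R$-module, i.e. $A$ is a finitely generated $R$-module and $\operatorname{depth}_{R_{\mathfrak m}}A_{\mathfrak m}=\dim R_{\mathfrak m}$ for every maximal ideal $\mathfrak m$ of $R$. Then $A$ is homologically homogeneous: it is a module-finite algebra over the Noetherian ring $R$, and for every prime ideal $P$ of $R$ 1. $\operatorname{gl\,dim}A_P=\dim R_P$, and 2. $A_P$ is a maximal Cohen–Macaulay $R_P$-module, i.e. finitely generated with $\operatorname{depth}_{R_P}A_P=\dim R_P$. Hence $A$ is a non-commutative crepant resolution of $R$, i.e. a homologically homogeneous $R$-algebra of the form $\operatorname{End}_R(N)$ with $N$ a reflexive $R$-module. Conventions: $\operatorname{gl\,dim}$ is the supremum of the projective dimensions of right modules, and the zero module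 has depth $\infty$, so that it is not maximal Cohen–Macaulay and $M\neq 0$. -/

import Mathlib

open CategoryTheory

universe u

noncomputable section

/-- The (right) global dimension of a ring `A`: the supremum of the projective dimensions of all
right `A`-modules, a right `A`-module being a module over the opposite ring. The zero module has
projective dimension `⊥`. -/
def rightGlobalDimension (A : Type u) [Ring A] : WithBot ℕ∞ :=
  ⨆ N : ModuleCat.{u} Aᵐᵒᵖ, projectiveDimension N

/-- The depth of a module `N` over a local ring `R`: the supremum of the lengths of the
`N`-regular sequences in the maximal ideal. For `N` finitely generated and nonzero over a
Noetherian `R`, the condition `N ≠ (r₁, …, rₙ) N` on a regular sequence in the maximal ideal is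
automatic (Nakayama); without it, the zero module gets depth `∞`, as usual. -/
def localDepth (R N : Type*) [CommRing R] [IsLocalRing R] [AddCommGroup N] [Module R N] : ℕ∞ :=
  ⨆ rs : {rs : List R // (∀ r ∈ rs, r ∈ IsLocalRing.maximalIdeal R) ∧
    RingTheory.Sequence.IsWeaklyRegular N rs}, (rs.1.length : ℕ∞)

/-- A (maximal) Cohen-Macaulay module over a Noetherian local ring: a finitely generated module
whose depth is the Krull dimension of the ring. -/
structure IsLocalMaximalCohenMacaulay (R N : Type*) [CommRing R] [IsLocalRing R]
    [AddCommGroup N] [Module R N] : Prop where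
  finite : Module.Finite R N
  depth_eq : ((localDepth R N : ℕ∞) : WithBot ℕ∞) = ringKrullDim R

/-- A (maximal) Cohen-Macaulay module over a Noetherian ring: a finitely generated module whose
localization at each maximal ideal `𝔪` is maximal Cohen-Macaulay over `R_𝔪`. -/
structure IsMaximalCohenMacaulay (R N : Type*) [CommRing R] [AddCommGroup N] [Module R N] :
    Prop where
  finite : Module.Finite R N
  localization : ∀ (P : Ideal R) [P.IsMaximal],
    IsLocalMaximalCohenMacaulay (Localization.AtPrime P) (LocalizedModule.AtPrime P N)

/-- A Gorenstein ring: a Noetherian ring whose localization at each maximal ideal has finite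
injective dimension as a module over itself. -/
structure IsGorensteinRing (R : Type u) [CommRing R] : Prop where
  noetherian : IsNoetherianRing R
  injectiveDimension_lt_top : ∀ (P : Ideal R) [P.IsMaximal],
    injectiveDimension (ModuleCat.of (Localization.AtPrime P) (Localization.AtPrime P)) < ⊤

/-- An algebra `A` over a commutative ring `R` is homologically homogeneous if `R` is Noetherian,
`A` is module-finite over `R`, and, for each prime `P` of `R`, the global dimension of the ring
`A_P` is the Krull dimension of `R_P`, and `A_P` is a maximal Cohen-Macaulay `R_P`-module. -/
structure IsHomologicallyHomogeneous (R A : Type u) [CommRing R] [Ring A] [Algebra R A] :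
    Prop where
  noetherian : IsNoetherianRing R
  finite : Module.Finite R A
  globalDimension_eq : ∀ (P : Ideal R) [P.IsPrime],
    rightGlobalDimension (LocalizedModule.AtPrime P A) = ringKrullDim (Localization.AtPrime P)
  cohenMacaulay : ∀ (P : Ideal R) [P.IsPrime],
    IsLocalMaximalCohenMacaulay (Localization.AtPrime P) (LocalizedModule.AtPrime P A)

/-- A non-commutative crepant resolution of `R`: a homologically homogeneous `R`-algebra of the
form `End_R(N)` with `N` a reflexive `R`-module. -/
def IsNoncommutativeCrepantResolution (R A : Type u) [CommRing R] [Ring A] [Algebra R A] : Prop :=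
  IsHomologicallyHomogeneous R A ∧
    ∃ (N : Type u) (_ : AddCommGroup N) (_ : Module R N),
      Module.IsReflexive R N ∧ Nonempty (A ≃ₐ[R] Module.End R N)

end

/-! Fix a prime P, put d = dim R_P and let Γ be the opposite ring of A_P. Normality puts the trace
of every endomorphism of M in R, and reflexivity makes the trace form perfect: each R-linear form on
A is x ↦ t(ax) for a unique a (`exists_traceForm`). This property survives localization and
identifies Γ with its R_P-dual.

Over the Gorenstein ring R_P, Ext^i(N, R_P) = 0 for i > 0 and N maximal Cohen–Macaulay
(`subsingleton_ext_self_of_depthGE`). Through the form, Γ-linear maps into finitely generated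
projectives therefore extend along inclusions with maximal Cohen–Macaulay cokernel. A resolution of
a maximal Cohen–Macaulay Γ-module of finite projective dimension thus splits from its far end, so
the module is projective (`projective_of_depthGE`). Each syzygy gains one unit of depth up to d, so
finitely generated modules have projective dimension at most d, and Auslander's reduction to cyclic
modules bounds the global dimension by d. Conversely, a nonzero module of projective dimension < d
has positive depth, which Γ/𝔪Γ does not (`iSup_projectiveDimension_eq`).

Two transfers bring the hypotheses to P: finite global dimension localizes, by way of injective
modules (`forall_hasProjectiveDimensionLT_of_isLocalizedModule`), and maximal Cohen–Macaulayness
localizes, because the grade of a prime p is at least depth minus dim R/p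
(`DepthGE.of_isBaseChange`). -/

/-! ### Depth through Ext out of the residue field -/

section Depth

open CategoryTheory.Abelian IsLocalRing RingTheory.Sequence

variable {R : Type u} [CommRing R] [IsLocalRing R]

/-- The depth of `N` is at least `n`, in terms of the vanishing of `Ext` out of the residue
field. -/
def DepthGE (R : Type u) [CommRing R] [IsLocalRing R] (N : Type u) [AddCommGroup N] [Module R N]
    (n : ℕ) : Prop :=
  ∀ i < n, Subsingleton (Ext (ModuleCat.of R (ResidueField R)) (ModuleCat.of R N) i)

variable {N : Type u} [AddCommGroup N] [Module R N]

lemma DepthGE.mono {m n : ℕ} (h : DepthGE R N n) (hmn : m ≤ n) : DepthGE R N m :=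
  fun i hi ↦ h i (hi.trans_le hmn)

lemma DepthGE.zero : DepthGE R N 0 := fun i hi ↦ absurd hi (by simp)

lemma support_residueField :
    Module.support R (ResidueField R) = PrimeSpectrum.zeroLocus (maximalIdeal R) := by
  rw [Module.support_eq_zeroLocus]
  congr 2
  exact Ideal.annihilator_quotient

/-- Rees' theorem for the maximal ideal; Nakayama supplies properness, so weakly regular sequences
suffice. -/
lemma depthGE_iff_exists_isWeaklyRegular [IsNoetherianRing R] [Nontrivial N] [Module.Finite R N]
    {n : ℕ} : DepthGE R N n ↔
      ∃ rs : List R, rs.length = n ∧ (∀ r ∈ rs, r ∈ maximalIdeal R) ∧ IsWeaklyRegular N rs := by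
  have hlt : maximalIdeal R • (⊤ : Submodule R N) < ⊤ :=
    (Submodule.top_ne_ideal_smul_of_le_jacobson_annihilator
      (maximalIdeal_le_jacobson _)).symm.lt_top
  have : Module.Finite R (ResidueField R) := inferInstanceAs (Module.Finite R (R ⧸ maximalIdeal R))
  constructor
  · intro h
    obtain ⟨rs, h1, h2, h3⟩ := ModuleCat.exists_isRegular_of_exists_subsingleton_ext
      (maximalIdeal R) n (ModuleCat.of R N) hlt (ModuleCat.of R (ResidueField R))
      support_residueField h
    exact ⟨rs, h1, h2, h3.1⟩
  · rintro ⟨rs, rfl, h2, h3⟩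
    exact ModuleCat.subsingleton_ext_of_exists_isRegular (maximalIdeal R)
      (ModuleCat.of R (ResidueField R)) support_residueField.subset (ModuleCat.of R N) hlt rs h2
      (IsRegular.of_isWeaklyRegular_of_mem_maximalIdeal N h2 h3)

variable {X Y Z : Type u} [AddCommGroup X] [Module R X] [AddCommGroup Y] [Module R Y]
  [AddCommGroup Z] [Module R Z]

/-- The short exact sequence in `ModuleCat` given by linear maps. -/
lemma ModuleCat.shortExact_of_linearMap {S : Type u} [Ring S] {X Y Z : Type u} [AddCommGroup X]
    [Module S X] [AddCommGroup Y] [Module S Y] [AddCommGroup Z] [Module S Z]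
    (f : X →ₗ[S] Y) (g : Y →ₗ[S] Z) (hf : Function.Injective f) (hg : Function.Surjective g)
    (h : Function.Exact f g) :
    (ModuleCat.shortComplexOfCompEqZero f g h.linearMap_comp_eq_zero).ShortExact :=
  ModuleCat.shortComplex_shortExact _ h hf hg

/-- In the long exact sequence of Ext(k, -), Ext^i(k, X) sits between Ext^(i-1)(k, Z) and Ext^i(k,
Y). This is what makes syzygies gain depth. -/
lemma DepthGE.of_exact_left (f : X →ₗ[R] Y) (g : Y →ₗ[R] Z) (hf : Function.Injective f)
    (hg : Function.Surjective g) (h : Function.Exact f g) {n : ℕ} (hY : DepthGE R Y (n + 1))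
    (hZ : DepthGE R Z n) : DepthGE R X (n + 1) := by
  have hS := ModuleCat.shortExact_of_linearMap f g hf hg h
  intro i hi
  refine ⟨fun a b ↦ ?_⟩
  suffices ∀ a : Ext (ModuleCat.of R (ResidueField R)) (ModuleCat.of R X) i, a = 0 by
    rw [this a, this b]
  intro a
  cases i with
  | zero =>
    have := hY 0 (by omega)
    have : Mono (ModuleCat.ofHom f) := (ModuleCat.mono_iff_injective _).mpr hf
    exact Ext.postcomp_mk₀_injective_of_mono (ModuleCat.of R (ResidueField R)) (ModuleCat.ofHom f)
      (Subsingleton.elim _ _)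
  | succ i =>
    have h1 := hY (i + 1) (by omega)
    have h2 := hZ i (by omega)
    obtain ⟨b, hb⟩ := Ext.covariant_sequence_exact₁ (ModuleCat.of R (ResidueField R)) hS a
      (Subsingleton.elim (h := h1) _ _) rfl
    rw [← hb, Subsingleton.elim (h := h2) b 0, Ext.zero_comp]

lemma DepthGE.of_exact_right (f : X →ₗ[R] Y) (g : Y →ₗ[R] Z) (hf : Function.Injective f)
    (hg : Function.Surjective g) (h : Function.Exact f g) {n : ℕ} (hY : DepthGE R Y n)
    (hX : DepthGE R X (n + 1)) : DepthGE R Z n := by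
  have hS := ModuleCat.shortExact_of_linearMap f g hf hg h
  intro i hi
  refine ⟨fun a b ↦ ?_⟩
  suffices ∀ a : Ext (ModuleCat.of R (ResidueField R)) (ModuleCat.of R Z) i, a = 0 by
    rw [this a, this b]
  intro a
  have h1 := hX (i + 1) (by omega)
  have h2 := hY i (by omega)
  obtain ⟨b, hb⟩ := Ext.covariant_sequence_exact₃ (ModuleCat.of R (ResidueField R)) hS a rfl
    (Subsingleton.elim (h := h1) _ _)
  rw [← hb, Subsingleton.elim (h := h2) b 0, Ext.zero_comp]

/-- The identity of X factors through a finite power of Y, so every class in Ext(k, X) is a sum of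
classes passing through Ext(k, Y). -/
lemma DepthGE.of_sum_comp_eq_id {ι : Type*} [Fintype ι] (a : ι → (X →ₗ[R] Y)) (b : ι → (Y →ₗ[R] X))
    (hab : ∑ i, b i ∘ₗ a i = LinearMap.id) {n : ℕ} (hY : DepthGE R Y n) : DepthGE R X n := by
  intro i hi
  have hY := hY i hi
  refine ⟨fun x y ↦ ?_⟩
  suffices ∀ x : Ext (ModuleCat.of R (ResidueField R)) (ModuleCat.of R X) i, x = 0 by
    rw [this x, this y]
  intro x
  have hid : 𝟙 (ModuleCat.of R X) = ∑ j, ModuleCat.ofHom (a j) ≫ ModuleCat.ofHom (b j) := by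
    ext z
    have := LinearMap.congr_fun hab z
    simp only [LinearMap.sum_apply, LinearMap.comp_apply, LinearMap.id_apply] at this
    simp [ModuleCat.hom_sum, this]
  rw [← Ext.comp_mk₀_id x, hid, Ext.mk₀_sum, Ext.comp_sum]
  refine Finset.sum_eq_zero fun j _ ↦ ?_
  rw [← Ext.mk₀_comp_mk₀, ← Ext.comp_assoc_of_second_deg_zero,
    Subsingleton.elim (h := hY) (x.comp _ _) 0, Ext.zero_comp]

lemma eq_zero_of_depthGE_one (hN : DepthGE R N 1) {x : N} (hx : ∀ r ∈ maximalIdeal R, r • x = 0) :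
    x = 0 := by
  have := hN 0 one_pos
  let g : ResidueField R →ₗ[R] N := (maximalIdeal R).liftQ (LinearMap.toSpanSingleton R N x)
    (fun r hr ↦ by simpa using hx r hr)
  have h0 : ModuleCat.ofHom g = 0 := by
    apply Ext.homEquiv₀.symm.injective
    exact Subsingleton.elim _ _
  have h1 : g (Submodule.Quotient.mk 1) = x :=
    ((maximalIdeal R).liftQ_apply _ 1).trans (one_smul R x)
  rw [← h1, ← ModuleCat.hom_ofHom g, h0]
  rfl

end Depth

/-! ### Vanishing of Ext into a Gorenstein local ring -/

section ExtVanishing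

open CategoryTheory.Abelian IsLocalRing RingTheory.Sequence

variable {R : Type u} [CommRing R] {W : ModuleCat.{u} R}

lemma subsingleton_ext_of_forall_eq_zero {S : Type u} [Ring S] {X Y : ModuleCat.{u} S} {i : ℕ}
    (h : ∀ a : Ext X Y i, a = 0) : Subsingleton (Ext X Y i) :=
  ⟨fun a b ↦ by rw [h a, h b]⟩

lemma subsingleton_ext_of_exact {X Y Z : Type u} [AddCommGroup X] [Module R X] [AddCommGroup Y]
    [Module R Y] [AddCommGroup Z] [Module R Z] (f : X →ₗ[R] Y) (g : Y →ₗ[R] Z)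
    (hf : Function.Injective f) (hg : Function.Surjective g) (h : Function.Exact f g) {i : ℕ}
    (hX : Subsingleton (Ext (ModuleCat.of R X) W i))
    (hZ : Subsingleton (Ext (ModuleCat.of R Z) W i)) :
    Subsingleton (Ext (ModuleCat.of R Y) W i) := by
  have hS := ModuleCat.shortExact_of_linearMap f g hf hg h
  refine subsingleton_ext_of_forall_eq_zero fun a ↦ ?_
  obtain ⟨b, hb⟩ := Ext.contravariant_sequence_exact₂ hS W a (Subsingleton.elim (h := hX) _ _)
  rw [← hb, Subsingleton.elim (h := hZ) b 0, Ext.comp_zero]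

lemma subsingleton_ext_left_of_exact {S : Type u} [Ring S] {W : ModuleCat.{u} S} {X Y Z : Type u}
    [AddCommGroup X] [Module S X] [AddCommGroup Y]
    [Module S Y] [AddCommGroup Z] [Module S Z] (f : X →ₗ[S] Y) (g : Y →ₗ[S] Z)
    (hf : Function.Injective f) (hg : Function.Surjective g) (h : Function.Exact f g) {i : ℕ}
    (hY : Subsingleton (Ext (ModuleCat.of S Y) W i))
    (hZ : Subsingleton (Ext (ModuleCat.of S Z) W (i + 1))) :
    Subsingleton (Ext (ModuleCat.of S X) W i) := by
  have hS := ModuleCat.shortExact_of_linearMap f g hf hg h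
  refine subsingleton_ext_of_forall_eq_zero fun a ↦ ?_
  obtain ⟨b, hb⟩ := Ext.contravariant_sequence_exact₁ hS W a (add_comm 1 i)
    (Subsingleton.elim (h := hZ) _ _)
  rw [← hb, Subsingleton.elim (h := hY) b 0, Ext.comp_zero]

lemma subsingleton_ext_of_linearEquiv {X Y : Type u} [AddCommGroup X] [Module R X]
    [AddCommGroup Y] [Module R Y] (e : X ≃ₗ[R] Y) {i : ℕ}
    (h : Subsingleton (Ext (ModuleCat.of R X) W i)) :
    Subsingleton (Ext (ModuleCat.of R Y) W i) :=
  subsingleton_ext_of_exact (Z := PUnit.{u+1}) e.toLinearMap 0 e.injective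
    (fun x ↦ ⟨0, Subsingleton.elim _ _⟩)
    (fun y ↦ ⟨fun _ ↦ e.surjective y, fun _ ↦ rfl⟩) h
    (subsingleton_ext_of_forall_eq_zero fun a ↦ by
      have hz : Limits.IsZero (ModuleCat.of R PUnit.{u+1}) :=
        ModuleCat.isZero_of_subsingleton _
      rw [← Ext.mk₀_id_comp a, hz.eq_of_src (𝟙 _) 0, Ext.mk₀_zero, Ext.zero_comp])

variable [IsLocalRing R] [IsNoetherianRing R]

/-- Vanishing of the next Ext of N/xN makes x surjective on Ext^i(N, W), a finitely generated
module, so Nakayama applies. -/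
lemma subsingleton_ext_of_quotSMulTop [Module.Finite R W] {N : Type u} [AddCommGroup N]
    [Module R N] [Module.Finite R N] {x : R} (hx : x ∈ maximalIdeal R) (hreg : IsSMulRegular N x)
    {i : ℕ} (h : Subsingleton (Ext (ModuleCat.of R (QuotSMulTop x N)) W (i + 1))) :
    Subsingleton (Ext (ModuleCat.of R N) W i) := by
  have hS : (ModuleCat.smulShortComplex (ModuleCat.of R N) x).ShortExact :=
    IsSMulRegular.smulShortComplex_shortExact (M := ModuleCat.of R N) hreg
  by_contra hne
  rw [not_subsingleton_iff_nontrivial] at hne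
  refine Submodule.top_ne_pointwise_smul_of_mem_jacobson_annihilator
    (maximalIdeal_le_jacobson (Module.annihilator R (Ext (ModuleCat.of R N) W i)) hx) ?_
  rw [eq_comm, eq_top_iff]
  intro y _
  obtain ⟨z, hz⟩ := Ext.contravariant_sequence_exact₁ hS W y (add_comm 1 i)
    (Subsingleton.elim (h := h) _ _)
  replace hz : (Ext.mk₀ (x • 𝟙 (ModuleCat.of R N))).comp (show Ext (ModuleCat.of R N) W i from z)
    (zero_add i) = y := hz
  rw [Ext.mk₀_smul, Ext.smul_comp, Ext.mk₀_id_comp] at hz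
  rw [← hz]
  exact Submodule.smul_mem_pointwise_smul _ _ ⊤ trivial

/-- Dévissage along a prime filtration: on R/p with p ≠ 𝔪, any x in 𝔪 outside p is regular, and the
quotient by x has vanishing Ext^(s+1). -/
lemma subsingleton_ext_of_residueField [Module.Finite R W] {s : ℕ}
    (hs : ∀ (N : Type u) [AddCommGroup N] [Module R N] [Module.Finite R N],
      Subsingleton (Ext (ModuleCat.of R N) W (s + 1)))
    (hk : Subsingleton (Ext (ModuleCat.of R (ResidueField R)) W s))
    (N : Type u) [AddCommGroup N] [Module R N] [hN : Module.Finite R N] :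
    Subsingleton (Ext (ModuleCat.of R N) W s) := by
  induction hN using IsNoetherianRing.induction_on_isQuotientEquivQuotientPrime R with
  | subsingleton N =>
    refine subsingleton_ext_of_forall_eq_zero fun a ↦ ?_
    have hz : Limits.IsZero (ModuleCat.of R N) := ModuleCat.isZero_of_subsingleton _
    rw [← Ext.mk₀_id_comp a, hz.eq_of_src (𝟙 _) 0, Ext.mk₀_zero, Ext.zero_comp]
  | quotient N p e =>
    refine subsingleton_ext_of_linearEquiv e.symm ?_
    by_cases hp : p.1 = maximalIdeal R
    · rw [hp]
      exact hk
    · obtain ⟨x, hx, hxp⟩ := SetLike.exists_of_lt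
        (lt_of_le_of_ne (le_maximalIdeal p.2.ne_top) hp)
      refine subsingleton_ext_of_quotSMulTop hx ?_ (hs _)
      rw [isSMulRegular_iff_right_eq_zero_of_smul]
      intro y hy
      obtain ⟨y, rfl⟩ := Ideal.Quotient.mk_surjective y
      have : Ideal.Quotient.mk p.1 (x * y) = 0 := hy
      rw [Ideal.Quotient.eq_zero_iff_mem] at this ⊢
      exact (p.2.mem_or_mem this).resolve_left hxp
  | exact N₁ N₂ N₃ f g hf hg hfg h₁ h₃ => exact subsingleton_ext_of_exact f g hf hg hfg h₁ h₃

lemma length_le_supportDim {N : Type u} [AddCommGroup N] [Module R N] [Module.Finite R N]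
    [Nontrivial N] {rs : List R} (hrs : ∀ r ∈ rs, r ∈ maximalIdeal R) (h : IsWeaklyRegular N rs) :
    (rs.length : WithBot ℕ∞) ≤ Module.supportDim R N := by
  have := Module.supportDim_add_length_eq_supportDim_of_isRegular rs
    (IsRegular.of_isWeaklyRegular_of_mem_maximalIdeal N hrs h)
  have h2 := (IsRegular.of_isWeaklyRegular_of_mem_maximalIdeal N hrs h).quot_ofList_smul_nontrivial ⊤
  rw [← this]
  refine le_add_of_nonneg_left ?_
  exact Order.krullDim_nonneg_iff.mpr Module.nonempty_support_of_nontrivial.to_subtype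

lemma DepthGE.le_ringKrullDim {N : Type u} [AddCommGroup N] [Module R N] [Module.Finite R N]
    [Nontrivial N] {n : ℕ} (h : DepthGE R N n) : (n : WithBot ℕ∞) ≤ ringKrullDim R := by
  obtain ⟨rs, rfl, h1, h2⟩ := depthGE_iff_exists_isWeaklyRegular.mp h
  exact (length_le_supportDim h1 h2).trans (Module.supportDim_le_ringKrullDim R N)

/-- Over a Noetherian local ring of finite injective dimension, `Ext` into the ring vanishes above
the depth. -/
lemma exists_forall_subsingleton_ext_self
    (hinj : injectiveDimension (ModuleCat.of R R) < ⊤) :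
    ∃ t : ℕ, (t : WithBot ℕ∞) ≤ ringKrullDim R ∧
      ∀ (N : Type u) [AddCommGroup N] [Module R N] [Module.Finite R N], ∀ i > t,
        Subsingleton (Ext (ModuleCat.of R N) (ModuleCat.of R R) i) := by
  -- Here t is the depth of R, which is finite because it is bounded by the dimension.
  obtain ⟨t, ht, ht'⟩ : ∃ t, DepthGE R R t ∧ ¬ DepthGE R R (t + 1) := by
    by_contra! H
    have hall : ∀ n, DepthGE R R n := fun n ↦ by
      induction n with
      | zero => exact .zero
      | succ n ih => exact H n ih
    have hfin : ringKrullDim R < ⊤ := ringKrullDim_lt_top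
    obtain ⟨n, hn⟩ : ∃ n : ℕ, ringKrullDim R < n := by
      have hbot : ringKrullDim R ≠ ⊥ := ringKrullDim_ne_bot
      obtain ⟨m, hm⟩ := WithBot.ne_bot_iff_exists.mp hbot
      rw [← hm] at hfin ⊢
      obtain ⟨k, rfl⟩ := ENat.ne_top_iff_exists.mp (fun h : m = ⊤ ↦ by simp [h] at hfin)
      exact ⟨k + 1, by exact_mod_cast k.lt_succ_self⟩
    exact absurd ((hall n).le_ringKrullDim) (not_le.mpr hn)
  refine ⟨t, ht.le_ringKrullDim, ?_⟩
  obtain ⟨rs, hlen, hmem, hreg⟩ := depthGE_iff_exists_isWeaklyRegular.mp ht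
  let T := R ⧸ Ideal.ofList rs • (⊤ : Submodule R R)
  have hTnt : Nontrivial T := (IsRegular.of_isWeaklyRegular_of_mem_maximalIdeal R hmem
    hreg).quot_ofList_smul_nontrivial ⊤
  have hpd : HasProjectiveDimensionLE (ModuleCat.of R T) t := by
    have := ModuleCat.projectiveDimension_quotient_eq_add_length_of_isWeaklyRegular (ModuleCat.of R R)
      rs hreg hmem
    rw [ModuleCat.projectiveDimension_eq_zero_of_projective (ModuleCat.of R R), zero_add,
      hlen] at this
    exact (projectiveDimension_le_iff _ _).mp this.le
  -- A regular element on T would lengthen the maximal regular sequence `rs`. Hence T has depth 0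
  -- and contains a copy of the residue field.
  have hT : ¬ DepthGE R T 1 := fun h ↦ by
    obtain ⟨xs, h1, h2, h3⟩ := depthGE_iff_exists_isWeaklyRegular.mp h
    exact ht' (depthGE_iff_exists_isWeaklyRegular.mpr ⟨rs ++ xs, by simp [h1, hlen],
      by simpa [or_imp, forall_and] using ⟨hmem, h2⟩,
      (isWeaklyRegular_append_iff R rs xs).mpr ⟨hreg, h3⟩⟩)
  obtain ⟨f, hf⟩ : ∃ f : ResidueField R →ₗ[R] T, f ≠ 0 := by
    by_contra! H
    refine hT fun i hi ↦ ?_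
    obtain rfl : i = 0 := by omega
    have : Subsingleton (ResidueField R →ₗ[R] T) := ⟨fun a b ↦ by rw [H a, H b]⟩
    exact (Ext.addEquiv₀.trans ModuleCat.homAddEquiv).subsingleton
  have : IsSimpleModule R (ResidueField R) :=
    (isSimpleModule_iff_isCoatom.mpr (maximalIdeal.isMaximal R).out :
      IsSimpleModule R (R ⧸ maximalIdeal R))
  have hfinj : Function.Injective f := LinearMap.injective_of_ne_zero hf
  obtain ⟨n, hn⟩ := (injectiveDimension_ne_top_iff _).mp hinj.ne
  -- Descending induction on i, starting above the injective dimension n. Ext^i(k, R) lies between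
  -- Ext^i(T, R), zero as pd T ≤ t < i, and Ext^(i+1)(T/k, R), zero by induction.
  have key : ∀ j : ℕ, ∀ (N : Type u) [AddCommGroup N] [Module R N] [Module.Finite R N], ∀ i > t,
      n < i + j → Subsingleton (Ext (ModuleCat.of R N) (ModuleCat.of R R) i) := by
    intro j
    induction j with
    | zero =>
      intro N _ _ _ i _ hi
      exact HasInjectiveDimensionLT.subsingleton (ModuleCat.of R R) (n + 1) i hi _
    | succ j ih =>
      intro N _ _ _ i hit hi
      refine subsingleton_ext_of_residueField (fun N _ _ _ ↦ ih N (i + 1) (by omega) (by omega)) ?_ N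
      exact subsingleton_ext_left_of_exact f (LinearMap.range f).mkQ hfinj
        (Submodule.mkQ_surjective _) (LinearMap.exact_map_mkQ_range f)
        (HasProjectiveDimensionLT.subsingleton (ModuleCat.of R T) (t + 1) i hit _)
        (ih _ (i + 1) (by omega) (by omega))
  exact fun N _ _ _ i hi ↦ key (n + 1) N i hi (by omega)

/-- Over a Gorenstein local ring, `Ext` from a maximal Cohen-Macaulay module into the ring
vanishes in positive degrees. -/
lemma subsingleton_ext_self_of_depthGE (hinj : injectiveDimension (ModuleCat.of R R) < ⊤)
    {d : ℕ} (hd : ringKrullDim R = d) {N : Type u} [AddCommGroup N] [Module R N]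
    [Module.Finite R N] (hN : DepthGE R N d) {i : ℕ} (hi : 0 < i) :
    Subsingleton (Ext (ModuleCat.of R N) (ModuleCat.of R R) i) := by
  obtain ⟨t, ht, h⟩ := exists_forall_subsingleton_ext_self hinj
  have htd : t ≤ d := by
    rw [hd] at ht
    exact_mod_cast ht
  cases subsingleton_or_nontrivial N with
  | inl _ =>
    refine subsingleton_ext_of_forall_eq_zero fun a ↦ ?_
    have hz : Limits.IsZero (ModuleCat.of R N) := ModuleCat.isZero_of_subsingleton _
    rw [← Ext.mk₀_id_comp a, hz.eq_of_src (𝟙 _) 0, Ext.mk₀_zero, Ext.zero_comp]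
  | inr _ =>
    obtain ⟨rs, hlen, hmem, hreg⟩ := depthGE_iff_exists_isWeaklyRegular.mp hN
    -- All that is used is i + length > t: dividing by a regular element trades one unit of length
    -- for one of i, leaving the sum unchanged.
    have hi' : t < i + rs.length := by omega
    clear hlen hN
    induction rs generalizing N i with
    | nil => exact h N i hi'
    | cons x rs ih =>
      rw [isWeaklyRegular_cons_iff] at hreg
      have hx : x ∈ maximalIdeal R := hmem x (by simp)
      have := nontrivial_quotSMulTop_of_mem_maximalIdeal N hx
      refine subsingleton_ext_of_quotSMulTop hx hreg.1 ?_
      exact ih (Nat.succ_pos i) ‹_› (fun r hr ↦ hmem r (by simp [hr])) hreg.2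
        (by simp at hi'; omega)

end ExtVanishing

/-! ### Algebras with a perfect form and relative injectivity -/

section FrobeniusForm

open CategoryTheory.Abelian IsLocalRing

lemma exists_comp_eq_of_subsingleton_ext {R : Type u} [Ring R] {P Q W : Type u}
    [AddCommGroup P] [Module R P] [AddCommGroup Q] [Module R Q] [AddCommGroup W] [Module R W]
    (f : P →ₗ[R] Q) (hf : Function.Injective f)
    (h : Subsingleton (Ext (ModuleCat.of R (Q ⧸ LinearMap.range f)) (ModuleCat.of R W) 1))
    (g : P →ₗ[R] W) : ∃ g' : Q →ₗ[R] W, g' ∘ₗ f = g := by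
  have hS := ModuleCat.shortExact_of_linearMap f (LinearMap.range f).mkQ hf
    (Submodule.mkQ_surjective _) (LinearMap.exact_map_mkQ_range f)
  obtain ⟨x, hx⟩ := Ext.contravariant_sequence_exact₁ hS (ModuleCat.of R W)
    (Ext.mk₀ (ModuleCat.ofHom g)) (add_zero 1) (Subsingleton.elim (h := h) _ _)
  obtain ⟨y, rfl⟩ := (Ext.mk₀_bijective _ _).2 x
  rw [Ext.mk₀_comp_mk₀] at hx
  have hy := (Ext.mk₀_bijective _ _).1 hx
  exact ⟨y.hom, congrArg ModuleCat.Hom.hom hy⟩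

variable {R : Type u} [CommRing R] {Γ : Type u} [Ring Γ] [Algebra R Γ]
  {P Q K : Type u} [AddCommGroup P] [Module R P] [Module Γ P] [IsScalarTower R Γ P]
  [AddCommGroup Q] [Module R Q] [Module Γ Q] [IsScalarTower R Γ Q]
  [AddCommGroup K] [Module R K] [Module Γ K] [IsScalarTower R Γ K]

/-- If every `R`-linear form on `Γ` is of the form `x ↦ t (x * g)` for a unique `g`, then
`Γ`-linear maps to `Γ` extend as soon as `R`-linear maps to `R` do. -/
lemma exists_extend_of_form (t : Γ →ₗ[R] R)
    (ht : ∀ l : Γ →ₗ[R] R, ∃! g : Γ, ∀ x, l x = t (x * g)) (f : P →ₗ[Γ] Q)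
    (hext : ∀ g : P →ₗ[R] R, ∃ h : Q →ₗ[R] R, h ∘ₗ f.restrictScalars R = g) (φ : P →ₗ[Γ] Γ) :
    ∃ ψ : Q →ₗ[Γ] Γ, ψ ∘ₗ f = φ := by
  have huniq : ∀ a b : Γ, (∀ x, t (x * a) = t (x * b)) → a = b := fun a b hab ↦
    (ht (t ∘ₗ LinearMap.mulRight R a)).unique (fun x ↦ rfl) hab
  obtain ⟨h, hh⟩ := hext (t ∘ₗ φ.restrictScalars R)
  have hh' : ∀ p, h (f p) = t (φ p) := fun p ↦ LinearMap.congr_fun hh p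
  -- After extending t ∘ φ to h : Q → R, the value ψ q is the element representing the form x ↦ h (x
  -- • q). Uniqueness of representing elements gives linearity.
  choose ψ hψ _ using fun q : Q ↦ ht (h ∘ₗ (LinearMap.toSpanSingleton Γ Q q).restrictScalars R)
  simp only [LinearMap.comp_apply, LinearMap.restrictScalars_apply,
    LinearMap.toSpanSingleton_apply] at hψ
  refine ⟨{ toFun := ψ, map_add' := fun a b ↦ huniq _ _ fun x ↦ ?_,
            map_smul' := fun y q ↦ huniq _ _ fun x ↦ ?_ }, ?_⟩
  · rw [← hψ, smul_add, map_add, hψ, hψ, mul_add, map_add]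
  · rw [← hψ, smul_smul, hψ, RingHom.id_apply, smul_eq_mul, mul_assoc]
  · ext p
    refine huniq _ _ fun x ↦ ?_
    change t (x * ψ (f p)) = _
    rw [← hψ, ← map_smul, hh', map_smul, smul_eq_mul]

/-- P is a retract of some Γ^n, so the extension property of Γ, applied to each coordinate, extends
the identity of P to Q. -/
lemma exists_leftInverse_of_form (t : Γ →ₗ[R] R)
    (ht : ∀ l : Γ →ₗ[R] R, ∃! g : Γ, ∀ x, l x = t (x * g)) [Module.Finite Γ P]
    [Module.Projective Γ P] (f : P →ₗ[Γ] Q)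
    (hext : ∀ g : P →ₗ[R] R, ∃ h : Q →ₗ[R] R, h ∘ₗ f.restrictScalars R = g) :
    ∃ ψ : Q →ₗ[Γ] P, ψ ∘ₗ f = LinearMap.id := by
  obtain ⟨n, a, b, -, -, hab⟩ := Module.Finite.exists_comp_eq_id_of_projective Γ P
  choose ψ hψ using fun i ↦ exists_extend_of_form t ht f hext (LinearMap.proj i ∘ₗ b)
  refine ⟨a ∘ₗ LinearMap.pi ψ, ?_⟩
  rw [← hab, LinearMap.comp_assoc]
  congr 1
  ext p i
  exact LinearMap.congr_fun (hψ i) p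

lemma ModuleCat.hasProjectiveDimensionLT_one_iff_projective {S : Type u} [Ring S] {N : Type u}
    [AddCommGroup N] [Module S N] :
    HasProjectiveDimensionLT (ModuleCat.of S N) 1 ↔ Module.Projective S N := by
  rw [← projective_iff_hasProjectiveDimensionLT_one, ← IsProjective.iff_projective]

/-! ### Depth and projective dimension over the algebra -/

section Syzygy

lemma DepthGE.of_projective [IsLocalRing R] {d : ℕ} (hΓ : DepthGE R Γ d) [Module.Finite Γ P]
    [Module.Projective Γ P] : DepthGE R P d := by
  obtain ⟨n, a, b, -, -, hab⟩ := Module.Finite.exists_comp_eq_id_of_projective Γ P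
  refine DepthGE.of_sum_comp_eq_id (fun i : Fin n ↦ (LinearMap.proj i ∘ₗ b).restrictScalars R)
    (fun i ↦ (a ∘ₗ LinearMap.single Γ (fun _ ↦ Γ) i).restrictScalars R) ?_ hΓ
  ext p
  have hp := LinearMap.congr_fun hab p
  simp only [LinearMap.comp_apply, LinearMap.id_apply] at hp
  simp only [LinearMap.sum_apply, LinearMap.comp_apply, LinearMap.restrictScalars_apply,
    LinearMap.id_apply, LinearMap.proj_apply, LinearMap.single_apply, ← map_sum]
  rw [Finset.univ_sum_single, hp]

variable [IsNoetherianRing R] [Module.Finite R Γ]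

variable (R Γ K) in
/-- A finitely generated module has a finitely generated first syzygy. -/
lemma exists_finite_syzygy [Module.Finite R K] : ∃ (n : ℕ) (π : (Fin n → Γ) →ₗ[Γ] K),
    Function.Surjective π ∧ Module.Finite R (LinearMap.ker π) := by
  have : Module.Finite Γ K := .of_restrictScalars_finite R Γ K
  obtain ⟨n, π, hπ⟩ := Module.Finite.exists_fin' Γ K
  exact ⟨n, π, hπ, .of_injective ((LinearMap.ker π).subtype.restrictScalars R)
    (Submodule.subtype_injective _)⟩

variable [IsLocalRing R] {d : ℕ}

omit [IsNoetherianRing R] [Module.Finite R Γ] in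
lemma DepthGE.ker {n : ℕ} (hΓ : DepthGE R Γ d) {π : (Fin n → Γ) →ₗ[Γ] K}
    (hπ : Function.Surjective π) {j : ℕ} (hj : j < d) (hK : DepthGE R K j) :
    DepthGE R (LinearMap.ker π) (j + 1) :=
  DepthGE.of_exact_left ((LinearMap.ker π).subtype.restrictScalars R) (π.restrictScalars R)
    (Submodule.subtype_injective _) hπ (LinearMap.exact_subtype_ker_map π)
    ((hΓ.of_projective (P := Fin n → Γ)).mono hj) hK

/-- A maximal Cohen-Macaulay module of finite projective dimension over a Gorenstein order is
projective. -/
lemma projective_of_depthGE (hinj : injectiveDimension (ModuleCat.of R R) < ⊤)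
    (hd : ringKrullDim R = d) (t : Γ →ₗ[R] R)
    (ht : ∀ l : Γ →ₗ[R] R, ∃! g : Γ, ∀ x, l x = t (x * g)) (hΓ : DepthGE R Γ d) {n : ℕ}
    [Module.Finite R K] (hK : DepthGE R K d)
    (hpd : HasProjectiveDimensionLT (ModuleCat.of Γ K) (n + 1)) : Module.Projective Γ K := by
  induction n generalizing K with
  | zero => exact ModuleCat.hasProjectiveDimensionLT_one_iff_projective.mp hpd
  | succ n ih =>
    obtain ⟨m, π, hπ, _⟩ := exists_finite_syzygy R Γ K
    have hS := ModuleCat.shortExact_of_linearMap (LinearMap.ker π).subtype π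
      (Submodule.subtype_injective _) hπ (LinearMap.exact_subtype_ker_map π)
    have hker : DepthGE R (LinearMap.ker π) d := by
      cases d with
      | zero => exact .zero
      | succ d => exact hΓ.ker hπ d.lt_succ_self (hK.mono d.le_succ)
    have hproj : Module.Projective Γ (LinearMap.ker π) :=
      ih hker ((hS.hasProjectiveDimensionLT_X₃_iff n
        (ModuleCat.projective_of_free (Pi.basisFun Γ (Fin m)))).mp hpd)
    have : Module.Finite Γ (LinearMap.ker π) := .of_restrictScalars_finite R Γ _
    let e : ((Fin m → Γ) ⧸ LinearMap.range ((LinearMap.ker π).subtype.restrictScalars R)) ≃ₗ[R] K :=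
      (Submodule.quotEquivOfEq _ (LinearMap.ker (π.restrictScalars R)) (by ext; simp)).trans
        ((π.restrictScalars R).quotKerEquivOfSurjective hπ)
    -- K is the cokernel of the inclusion of the projective syzygy, and Ext^1_R(K, R) = 0, so
    -- R-linear forms extend and the inclusion splits.
    obtain ⟨ψ, hψ⟩ := exists_leftInverse_of_form t ht (LinearMap.ker π).subtype
      (exists_comp_eq_of_subsingleton_ext _ (Submodule.subtype_injective _)
        (subsingleton_ext_of_linearEquiv e.symm
          (subsingleton_ext_self_of_depthGE hinj hd hK one_pos)))
    have hsplit := (LinearMap.exact_subtype_ker_map π).split_tfae'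
    obtain ⟨-, σ, hσ⟩ := (hsplit.out 1 0 rfl rfl).mp ⟨hπ, ψ, hψ⟩
    exact Module.Projective.of_split σ π hσ

/-- One half of an Auslander–Buchsbaum formula: after j syzygies the depth has risen to d, where
finite projective dimension forces projectivity. -/
lemma hasProjectiveDimensionLT_of_depthGE (hinj : injectiveDimension (ModuleCat.of R R) < ⊤)
    (hd : ringKrullDim R = d) (t : Γ →ₗ[R] R)
    (ht : ∀ l : Γ →ₗ[R] R, ∃! g : Γ, ∀ x, l x = t (x * g)) (hΓ : DepthGE R Γ d) {n : ℕ}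
    (hpd : ∀ N : ModuleCat.{u} Γ, HasProjectiveDimensionLT N n) {j : ℕ} (hj : j ≤ d)
    [Module.Finite R K] (hK : DepthGE R K (d - j)) :
    HasProjectiveDimensionLT (ModuleCat.of Γ K) (j + 1) := by
  induction j generalizing K with
  | zero =>
    have := hpd (ModuleCat.of Γ K)
    exact ModuleCat.hasProjectiveDimensionLT_one_iff_projective.mpr
      (projective_of_depthGE hinj hd t ht hΓ hK
        (hasProjectiveDimensionLT_of_ge _ n (n + 1) n.le_succ))
  | succ j ih =>
    obtain ⟨m, π, hπ, _⟩ := exists_finite_syzygy R Γ K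
    have hS := ModuleCat.shortExact_of_linearMap (LinearMap.ker π).subtype π
      (Submodule.subtype_injective _) hπ (LinearMap.exact_subtype_ker_map π)
    refine (hS.hasProjectiveDimensionLT_X₃_iff j
        (ModuleCat.projective_of_free (Pi.basisFun Γ (Fin m)))).mpr (ih (by omega) ?_)
    have := hΓ.ker hπ (by omega) hK
    rwa [show d - (j + 1) + 1 = d - j by omega] at this

/-- The other half: going back along a projective resolution loses at most one unit of depth per
step. Neither the form nor the Gorenstein property enters. -/
lemma DepthGE.of_hasProjectiveDimensionLT (hΓ : DepthGE R Γ d) {j : ℕ} (hj : j ≤ d)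
    [Module.Finite R K] (hK : HasProjectiveDimensionLT (ModuleCat.of Γ K) (j + 1)) :
    DepthGE R K (d - j) := by
  induction j generalizing K with
  | zero =>
    have := ModuleCat.hasProjectiveDimensionLT_one_iff_projective.mp hK
    have : Module.Finite Γ K := .of_restrictScalars_finite R Γ K
    exact hΓ.of_projective
  | succ j ih =>
    obtain ⟨m, π, hπ, _⟩ := exists_finite_syzygy R Γ K
    have hS := ModuleCat.shortExact_of_linearMap (LinearMap.ker π).subtype π
      (Submodule.subtype_injective _) hπ (LinearMap.exact_subtype_ker_map π)
    have h1 := ih (by omega) ((hS.hasProjectiveDimensionLT_X₃_iff j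
        (ModuleCat.projective_of_free (Pi.basisFun Γ (Fin m)))).mp hK)
    refine DepthGE.of_exact_right ((LinearMap.ker π).subtype.restrictScalars R)
      (π.restrictScalars R) (Submodule.subtype_injective _) hπ (LinearMap.exact_subtype_ker_map π)
      ((hΓ.of_projective (P := Fin m → Γ)).mono (by omega)) ?_
    rwa [show d - (j + 1) + 1 = d - j by omega]

omit [IsNoetherianRing R] [Module.Finite R Γ] in
lemma mul_mem_maximalIdeal_smul_top (a : Γ) {x : Γ}
    (hx : x ∈ maximalIdeal R • (⊤ : Submodule R Γ)) :
    a * x ∈ maximalIdeal R • (⊤ : Submodule R Γ) := by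
  have h := Submodule.mem_map_of_mem (f := LinearMap.mulLeft R a) hx
  rw [Submodule.map_smul''] at h
  exact Submodule.smul_mono le_rfl le_top h

omit [IsNoetherianRing R] in
variable (R Γ) in
lemma maximalIdeal_smul_top_ne_top [Nontrivial Γ] :
    maximalIdeal R • (⊤ : Submodule R Γ) ≠ ⊤ :=
  (Submodule.top_ne_ideal_smul_of_le_jacobson_annihilator (R := R) (M := Γ)
    (maximalIdeal_le_jacobson _)).symm

omit [IsNoetherianRing R] in
variable (R Γ) in
lemma exists_leftIdeal_one_notMem [Nontrivial Γ] :
    ∃ I : Submodule Γ Γ, (∀ r ∈ maximalIdeal R, ∀ x : Γ, r • x ∈ I) ∧ 1 ∉ I := by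
  -- This is 𝔪Γ, a left ideal because R acts centrally, and proper by Nakayama.
  let I : Submodule Γ Γ :=
    { carrier := {x | x ∈ maximalIdeal R • (⊤ : Submodule R Γ)}
      add_mem' := fun ha hb ↦ Submodule.add_mem (maximalIdeal R • (⊤ : Submodule R Γ)) ha hb
      zero_mem' := Submodule.zero_mem (maximalIdeal R • (⊤ : Submodule R Γ))
      smul_mem' := fun a x hx ↦ mul_mem_maximalIdeal_smul_top a hx }
  have hI : ∀ x, x ∈ I ↔ x ∈ maximalIdeal R • (⊤ : Submodule R Γ) := fun _ ↦ Iff.rfl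
  refine ⟨I, fun r hr x ↦ ?_, fun h ↦ ?_⟩
  · rw [hI]
    exact Submodule.smul_mem_smul hr Submodule.mem_top
  refine maximalIdeal_smul_top_ne_top R Γ (top_le_iff.mp fun x _ ↦ ?_)
  rw [← mul_one x]
  exact mul_mem_maximalIdeal_smul_top x ((hI 1).mp h)

/-- For d > 0 the quotient has positive depth, so the class of 1, being killed by 𝔪, vanishes. For d
= 0 the quotient itself is zero. -/
lemma one_mem_of_hasProjectiveDimensionLT_quotient (hΓ : DepthGE R Γ d) {I : Submodule Γ Γ}
    [Module.Finite R (Γ ⧸ I)] (hI : ∀ r ∈ maximalIdeal R, ∀ x : Γ, r • x ∈ I)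
    (h : HasProjectiveDimensionLT (ModuleCat.of Γ (Γ ⧸ I)) d) : 1 ∈ I := by
  rw [← Submodule.Quotient.mk_eq_zero]
  cases d with
  | zero =>
    have := ModuleCat.subsingleton_of_isZero
      ((hasProjectiveDimensionLT_zero_iff_isZero (ModuleCat.of Γ (Γ ⧸ I))).mp h)
    exact Subsingleton.elim (α := Γ ⧸ I) _ _
  | succ d =>
    have hdepth := DepthGE.of_hasProjectiveDimensionLT (K := Γ ⧸ I) hΓ d.le_succ h
    rw [Nat.add_sub_cancel_left] at hdepth
    have hm : ∀ r ∈ maximalIdeal R, r • (Submodule.Quotient.mk 1 : Γ ⧸ I) = 0 := fun r hr ↦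
      (Submodule.Quotient.mk_eq_zero I).mpr (hI r hr 1)
    exact eq_zero_of_depthGE_one hdepth hm

omit [IsNoetherianRing R] [IsLocalRing R] in
variable (R) in
lemma finite_quotient_leftIdeal (I : Submodule Γ Γ) : Module.Finite R (Γ ⧸ I) :=
  Module.Finite.trans Γ (Γ ⧸ I)

lemma exists_not_hasProjectiveDimensionLT [Nontrivial Γ] (hΓ : DepthGE R Γ d) :
    ∃ N : ModuleCat.{u} Γ, ¬ HasProjectiveDimensionLT N d := by
  obtain ⟨I, hI, hne⟩ := exists_leftIdeal_one_notMem R Γ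
  have := finite_quotient_leftIdeal R I
  exact ⟨ModuleCat.of Γ (Γ ⧸ I), fun h ↦ hne (one_mem_of_hasProjectiveDimensionLT_quotient hΓ hI h)⟩

end Syzygy

end FrobeniusForm

/-! ### Global dimension: cyclic modules and the local theorem -/

section GlobalDimension

open CategoryTheory.Abelian IsLocalRing

variable {S : Type u} [Ring S]

/-- Both sides say that Ext^i vanishes for all pairs and all i ≥ n. This gives access to Baer's
criterion and to restriction of injectives. -/
lemma forall_hasProjectiveDimensionLT_iff {n : ℕ} :
    (∀ N : ModuleCat.{u} S, HasProjectiveDimensionLT N n) ↔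
      ∀ N : ModuleCat.{u} S, HasInjectiveDimensionLT N n :=
  ⟨fun h N ↦ .mk fun i hi Y _ ↦ (h Y).subsingleton _ _ i hi N |>.elim _ _,
    fun h N ↦ .mk fun i hi Y _ ↦ (h Y).subsingleton _ _ i hi N |>.elim _ _⟩

lemma baer_of_subsingleton_ext_one {X : ModuleCat.{u} S}
    (h : ∀ I : Ideal S, Subsingleton (Ext (ModuleCat.of S (S ⧸ I)) X 1)) : Module.Baer S X := by
  intro I g
  obtain ⟨g', hg'⟩ := exists_comp_eq_of_subsingleton_ext (W := X) I.subtype I.subtype_injective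
    (by rw [Submodule.range_subtype]; exact h I) g
  exact ⟨g', fun x hx ↦ LinearMap.congr_fun hg' ⟨x, hx⟩⟩

/-- Injective dimension is detected by `Ext` out of cyclic modules. -/
lemma hasInjectiveDimensionLT_of_subsingleton_ext {n : ℕ} {X : ModuleCat.{u} S}
    (h : ∀ I : Ideal S, Subsingleton (Ext (ModuleCat.of S (S ⧸ I)) X (n + 1))) :
    HasInjectiveDimensionLT X (n + 1) := by
  induction n generalizing X with
  | zero =>
    rw [zero_add, ← injective_iff_hasInjectiveDimensionLT_one,
      ← Module.injective_iff_injective_object S X]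
    exact (baer_of_subsingleton_ext_one h).injective
  | succ n ih =>
    obtain ⟨J, _, f, _⟩ := (inferInstance : EnoughInjectives (ModuleCat.{u} S)).1 X
    have hS : (ShortComplex.mk f (Limits.cokernel.π f) (Limits.cokernel.condition f)).ShortExact :=
      { exact := ShortComplex.exact_cokernel f }
    refine (hS.hasInjectiveDimensionLT_X₃_iff n ‹_›).mp (ih fun I ↦ ?_)
    refine subsingleton_ext_of_forall_eq_zero fun a ↦ ?_
    obtain ⟨b, hb⟩ := Ext.covariant_sequence_exact₃ (ModuleCat.of S (S ⧸ I)) hS a rfl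
      (Subsingleton.elim (h := h I) _ _)
    rw [← hb, show b = 0 from Ext.eq_zero_of_injective b, Ext.zero_comp]

/-- Auslander's theorem: the global dimension is determined by cyclic modules. -/
lemma forall_hasProjectiveDimensionLT_of_cyclic {n : ℕ}
    (h : ∀ I : Ideal S, HasProjectiveDimensionLT (ModuleCat.of S (S ⧸ I)) (n + 1))
    (N : ModuleCat.{u} S) : HasProjectiveDimensionLT N (n + 1) :=
  forall_hasProjectiveDimensionLT_iff.mpr (fun _ ↦ hasInjectiveDimensionLT_of_subsingleton_ext
    fun I ↦ (h I).subsingleton _ _ _ le_rfl _) N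

/-- A Gorenstein order over a Gorenstein local ring which is symmetric and of finite global
dimension has global dimension the dimension of the base. -/
theorem iSup_projectiveDimension_eq {R : Type u} [CommRing R] [IsNoetherianRing R] [IsLocalRing R]
    {Γ : Type u} [Ring Γ] [Algebra R Γ] [Module.Finite R Γ] [Nontrivial Γ]
    (hinj : injectiveDimension (ModuleCat.of R R) < ⊤) {d : ℕ}
    (hd : ringKrullDim R = d) (t : Γ →ₗ[R] R)
    (ht : ∀ l : Γ →ₗ[R] R, ∃! g : Γ, ∀ x, l x = t (x * g)) (hΓ : DepthGE R Γ d) {n : ℕ}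
    (hpd : ∀ N : ModuleCat.{u} Γ, HasProjectiveDimensionLT N n) :
    ⨆ N : ModuleCat.{u} Γ, projectiveDimension N = d := by
  apply le_antisymm
  · refine iSup_le fun N ↦ (projectiveDimension_le_iff N d).mpr
      (forall_hasProjectiveDimensionLT_of_cyclic (fun I ↦ ?_) N)
    have := finite_quotient_leftIdeal R I
    -- With j = d the depth required is 0, so every cyclic module qualifies.
    refine hasProjectiveDimensionLT_of_depthGE hinj hd t ht hΓ hpd le_rfl ?_
    rw [Nat.sub_self]
    exact .zero
  · obtain ⟨N, hN⟩ := exists_not_hasProjectiveDimensionLT hΓ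
    exact le_iSup_of_le N ((projectiveDimension_ge_iff N d).mpr hN)

end GlobalDimension

/-! ### Global dimension under central localization -/

section Localization

variable {R : Type u} [CommRing R] (S : Submonoid R) {Γ B : Type u} [Ring Γ] [Ring B]
  [Algebra R Γ] [Algebra R B] (φ : Γ →ₐ[R] B) [IsLocalizedModule S φ.toLinearMap]
  {I : Type u} [AddCommGroup I] [Module Γ I] [Module B I]

include S φ

omit [Module Γ I] in
lemma algebraMap_smul_injective_of_isLocalizedModule (s : S) :
    Function.Injective fun x : I ↦ algebraMap R B s • x := by
  have hu := (Module.End.isUnit_iff _).mp (IsLocalizedModule.map_units φ.toLinearMap s)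
  obtain ⟨u, hu⟩ := hu.2 1
  replace hu : u * algebraMap R B s = 1 := by
    rw [← Algebra.commutes, ← Algebra.smul_def]
    exact hu
  intro x y hxy
  simpa [smul_smul, hu] using congrArg (u • ·) hxy

lemma linearMap_smul_of_isLocalizedModule {J : Type u} [AddCommGroup J] [Module Γ J] [Module B J]
    (hI : ∀ (γ : Γ) (x : I), γ • x = φ γ • x) (hJ : ∀ (γ : Γ) (x : J), γ • x = φ γ • x)
    (h : J →ₗ[Γ] I) (b : B) (x : J) : h (b • x) = b • h x := by
  obtain ⟨⟨γ, s⟩, hs⟩ := IsLocalizedModule.surj S φ.toLinearMap b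
  replace hs : algebraMap R B s * b = φ γ := by
    rw [← Algebra.smul_def]
    exact hs
  apply algebraMap_smul_injective_of_isLocalizedModule S φ s
  have h1 : ∀ (r : R) (y : J), h (algebraMap R B r • y) = algebraMap R B r • h y := fun r y ↦ by
    rw [← φ.commutes, ← hJ, map_smul, hI]
  dsimp only
  rw [← h1, smul_smul, smul_smul, hs, ← hJ, map_smul, hI]

/-- An injective module over a localization is injective over the original ring. -/
lemma baer_of_isLocalizedModule (hI : ∀ (γ : Γ) (x : I), γ • x = φ γ • x)
    (hinj : Module.Baer B I) : Module.Baer Γ I := by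
  intro J g
  have hcancel := algebraMap_smul_injective_of_isLocalizedModule S φ (I := I)
  have hsmul : ∀ (r : R) (y : I), algebraMap R Γ r • y = algebraMap R B r • y := fun r y ↦ by
    rw [hI, φ.commutes]
  have hgsmul : ∀ (r : R) (j : Γ) (hj : j ∈ J), g ⟨algebraMap R Γ r * j, J.mul_mem_left _ hj⟩ =
      algebraMap R B r • g ⟨j, hj⟩ := fun r j hj ↦ by
    rw [← hsmul, ← map_smul]
    rfl
  -- The extension of J to B, described as the elements with a multiple by a denominator in φ(J).
  let J' : Ideal B :=
    { carrier := {b | ∃ s : S, ∃ j ∈ J, algebraMap R B s * b = φ j}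
      zero_mem' := ⟨1, 0, J.zero_mem, by simp⟩
      add_mem' := by
        rintro a b ⟨s, j, hj, h⟩ ⟨s', j', hj', h'⟩
        refine ⟨s * s', algebraMap R Γ s' * j + algebraMap R Γ s * j',
          J.add_mem (J.mul_mem_left _ hj) (J.mul_mem_left _ hj'), ?_⟩
        simp only [map_add, map_mul, φ.commutes, ← h, ← h', Submonoid.coe_mul, mul_add, mul_assoc]
        congr 1
        rw [← mul_assoc, ← mul_assoc, Algebra.commutes (s : R) (algebraMap R B s')]
      smul_mem' := by
        rintro a b ⟨s, j, hj, h⟩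
        obtain ⟨⟨γ, r⟩, hr⟩ := IsLocalizedModule.surj S φ.toLinearMap a
        replace hr : algebraMap R B r * a = φ γ := by
          rw [← Algebra.smul_def]
          exact hr
        refine ⟨r * s, γ * j, J.mul_mem_left _ hj, ?_⟩
        rw [map_mul, ← hr, ← h, Submonoid.coe_mul, map_mul, smul_eq_mul]
        simp only [mul_assoc]
        rw [← mul_assoc a, ← Algebra.commutes (s : R) a, mul_assoc] }
  -- The extended map sends b to s⁻¹ g(j) whenever sb = φ(j). Demanding this for all such (s, j) at
  -- once builds in well-definedness, so later steps may choose common denominators.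
  have hex : ∀ b : J', ∃ y : I, ∀ (s : S) (j : Γ) (hj : j ∈ J), algebraMap R B s * b = φ j →
      algebraMap R B s • y = g ⟨j, hj⟩ := by
    rintro ⟨b, s, j, hj, h⟩
    obtain ⟨u, hu⟩ := ((Module.End.isUnit_iff _).mp
      (IsLocalizedModule.map_units φ.toLinearMap s)).2 1
    replace hu : algebraMap R B s * u = 1 := by
      rw [← Algebra.smul_def]
      exact hu
    refine ⟨u • g ⟨j, hj⟩, fun s' j' hj' h' ↦ ?_⟩
    have heq : φ.toLinearMap (algebraMap R Γ s * j') = φ.toLinearMap (algebraMap R Γ s' * j) := by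
      simp only [AlgHom.toLinearMap_apply, map_mul, φ.commutes, ← h, ← h']
      rw [← mul_assoc, ← mul_assoc, Algebra.commutes (s : R) (algebraMap R B s')]
    obtain ⟨c, hc⟩ := IsLocalizedModule.exists_of_eq (S := S) heq
    have hc' : algebraMap R B c • algebraMap R B s • g ⟨j', hj'⟩ =
        algebraMap R B c • algebraMap R B s' • g ⟨j, hj⟩ := by
      rw [← hgsmul, ← hgsmul, ← hgsmul, ← hgsmul]
      congr 2
      simpa [Submonoid.smul_def, Algebra.smul_def] using hc
    apply hcancel s
    dsimp only
    rw [hcancel c hc', smul_smul, smul_smul, Algebra.commutes (s : R), mul_assoc, hu, mul_one]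
  choose g' hg' using hex
  have hadd : ∀ a b : J', g' (a + b) = g' a + g' b := by
    rintro ⟨a, s, j, hj, h⟩ ⟨b, s', j', hj', h'⟩
    apply hcancel (s * s')
    dsimp only
    have ha : algebraMap R B (s * s' : S) * a = φ (algebraMap R Γ s' * j) := by
      rw [map_mul, φ.commutes, ← h, mul_comm s s', Submonoid.coe_mul, map_mul, mul_assoc]
    have hb : algebraMap R B (s * s' : S) * b = φ (algebraMap R Γ s * j') := by
      rw [map_mul, φ.commutes, ← h', Submonoid.coe_mul, map_mul, mul_assoc]
    have h1 := hg' ⟨a, s, j, hj, h⟩ (s * s') (algebraMap R Γ s' * j) (J.mul_mem_left _ hj) ha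
    have h2 := hg' ⟨b, s', j', hj', h'⟩ (s * s') (algebraMap R Γ s * j') (J.mul_mem_left _ hj') hb
    rw [smul_add, h1, h2, ← map_add]
    refine hg' _ _ _ (J.add_mem (J.mul_mem_left _ hj) (J.mul_mem_left _ hj')) ?_
    rw [map_add, ← ha, ← hb, ← mul_add]
    rfl
  have hmul : ∀ (a : B) (b : J'), g' (a • b) = a • g' b := by
    rintro a ⟨b, s, j, hj, h⟩
    obtain ⟨⟨γ, r⟩, hr⟩ := IsLocalizedModule.surj S φ.toLinearMap a
    replace hr : algebraMap R B r * a = φ γ := by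
      rw [← Algebra.smul_def]
      exact hr
    apply hcancel (r * s)
    dsimp only
    have h1 := hg' (a • ⟨b, s, j, hj, h⟩) (r * s) (γ * j) (J.mul_mem_left _ hj) (by
      change _ * (a * b) = _
      rw [map_mul, ← hr, ← h, Submonoid.coe_mul, map_mul]
      simp only [mul_assoc]
      rw [← mul_assoc a, ← Algebra.commutes (s : R) a, mul_assoc])
    rw [h1, Submonoid.coe_mul, map_mul, smul_smul, mul_assoc, Algebra.commutes (s : R) a,
      ← mul_assoc, hr, mul_smul, hg' _ s j hj h, ← hI, ← map_smul]
    rfl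
  obtain ⟨h, hh⟩ := hinj J' { toFun := g', map_add' := hadd, map_smul' := hmul }
  refine ⟨{ toFun := fun γ ↦ h (φ γ), map_add' := by simp, map_smul' := fun a b ↦ ?_ },
    fun x hx ↦ ?_⟩
  · rw [smul_eq_mul, map_mul, ← smul_eq_mul, map_smul, hI, RingHom.id_apply]
  · have hx' : φ x ∈ J' := ⟨1, x, hx, by simp⟩
    have h1 := hg' ⟨φ x, hx'⟩ 1 x hx (by simp)
    change h (φ x) = _
    rw [hh _ hx', ← h1]
    simp

/-- Extend the map over Γ; a Γ-linear map between B-modules is automatically B-linear. -/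
lemma injective_of_isLocalizedModule (hI : ∀ (γ : Γ) (x : I), γ • x = φ γ • x)
    (hinj : Module.Injective Γ I) : Module.Baer B I := by
  intro J g
  let _ : Module Γ J := Module.compHom J φ.toRingHom
  let _ : Module Γ B := Module.compHom B φ.toRingHom
  let i : J →ₗ[Γ] B :=
    { toFun := fun x ↦ x, map_add' := fun _ _ ↦ rfl, map_smul' := fun _ _ ↦ rfl }
  let g₀ : J →ₗ[Γ] I :=
    { toFun := g, map_add' := map_add g
      map_smul' := fun a x ↦ (map_smul g (φ a) x).trans (hI a _).symm }
  obtain ⟨h, hh⟩ := hinj.out i Subtype.val_injective g₀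
  exact ⟨{ toFun := h, map_add' := map_add h
           map_smul' := linearMap_smul_of_isLocalizedModule S φ hI (fun _ _ ↦ rfl) h },
    fun x hx ↦ hh ⟨x, hx⟩⟩

omit S φ in
omit [Algebra R Γ] [Algebra R B] in
lemma shortExact_restrictScalars (f : Γ →+* B) {T : ShortComplex (ModuleCat.{u} B)}
    (hT : T.ShortExact) : (T.map (ModuleCat.restrictScalars.{u} f)).ShortExact where
  exact := by
    have h := hT.exact
    rw [ShortComplex.ShortExact.moduleCat_exact_iff_function_exact] at h ⊢
    exact h
  mono_f := (ModuleCat.mono_iff_injective _).mpr ((ModuleCat.mono_iff_injective T.f).mp hT.mono_f)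
  epi_g := (ModuleCat.epi_iff_surjective _).mpr ((ModuleCat.epi_iff_surjective T.g).mp hT.epi_g)

/-- Restriction of scalars is exact and preserves injectives, so cosyzygies over B restrict to
cosyzygies over Γ. -/
lemma hasInjectiveDimensionLT_of_restrictScalars {n : ℕ} {N : ModuleCat.{u} B}
    (h : HasInjectiveDimensionLT ((ModuleCat.restrictScalars φ.toRingHom).obj N) (n + 1)) :
    HasInjectiveDimensionLT N (n + 1) := by
  induction n generalizing N with
  | zero =>
    rw [zero_add, ← injective_iff_hasInjectiveDimensionLT_one,
      ← Module.injective_iff_injective_object] at h ⊢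
    exact (injective_of_isLocalizedModule S φ
      (I := (ModuleCat.restrictScalars φ.toRingHom).obj N) (fun _ _ ↦ rfl) h).injective
  | succ n ih =>
    obtain ⟨J, hJ, f, _⟩ := (inferInstance : EnoughInjectives (ModuleCat.{u} B)).1 N
    have hS : (ShortComplex.mk f (Limits.cokernel.π f) (Limits.cokernel.condition f)).ShortExact :=
      { exact := ShortComplex.exact_cokernel f }
    have hS' := shortExact_restrictScalars φ.toRingHom hS
    have hJ' : Injective ((ModuleCat.restrictScalars φ.toRingHom).obj J) := by
      rw [← Module.injective_iff_injective_object] at hJ ⊢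
      exact (baer_of_isLocalizedModule S φ
        (I := (ModuleCat.restrictScalars φ.toRingHom).obj J) (fun _ _ ↦ rfl)
        (Module.Baer.of_injective hJ)).injective
    exact (hS.hasInjectiveDimensionLT_X₃_iff n hJ).mp
      (ih ((hS'.hasInjectiveDimensionLT_X₃_iff n hJ').mpr h))

/-- Finiteness of the global dimension passes to localizations. -/
lemma forall_hasProjectiveDimensionLT_of_isLocalizedModule {n : ℕ}
    (h : ∀ N : ModuleCat.{u} Γ, HasProjectiveDimensionLT N (n + 1)) (N : ModuleCat.{u} B) :
    HasProjectiveDimensionLT N (n + 1) :=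
  forall_hasProjectiveDimensionLT_iff.mpr (fun _ ↦
    hasInjectiveDimensionLT_of_restrictScalars S φ
      (forall_hasProjectiveDimensionLT_iff.mp h _)) N

end Localization

/-! ### Depth, associated primes and grade -/

section DepthLocalization

open IsLocalRing RingTheory.Sequence Pointwise

variable {R : Type u} [CommRing R] [IsLocalRing R] [IsNoetherianRing R]

/-- The depth of a module is at most the dimension of each of its associated primes. -/
lemma length_le_coheight_of_isAssociatedPrime {M : Type u} [AddCommGroup M] [Module R M]
    [Module.Finite R M] {rs : List R} (hrs : ∀ r ∈ rs, r ∈ maximalIdeal R)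
    (h : IsWeaklyRegular M rs) {q : PrimeSpectrum R} (hq : IsAssociatedPrime q.asIdeal M) :
    (rs.length : ℕ∞) ≤ Order.coheight q := by
  induction rs generalizing M q with
  | nil => simp
  | cons x rs ih =>
    rw [isWeaklyRegular_cons_iff] at h
    have hx : x ∈ maximalIdeal R := hrs x (by simp)
    obtain ⟨-, y₀, hy₀⟩ := isAssociatedPrime_iff.mp hq
    have hy₀ne : y₀ ≠ 0 := fun h0 ↦ q.2.ne_top (by rw [hy₀, h0]; simp)
    let N := Submodule.torsionBySet R M q.asIdeal
    have hy₀N : y₀ ∈ N := by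
      rw [Submodule.mem_torsionBySet_iff]
      rintro ⟨r, hr⟩
      have hr' : r ∈ q.asIdeal := hr
      rw [hy₀, Submodule.mem_colon_singleton] at hr'
      simpa using hr'
    have hxq : x ∉ q.asIdeal := fun hxq ↦ hy₀ne (h.1.right_eq_zero_of_smul
      ((Submodule.mem_torsionBySet_iff _ _).mp hy₀N ⟨x, hxq⟩))
    -- N consists of the elements killed by q. If N lay in xM, regularity of x would give N = xN,
    -- and Nakayama would give N = 0.
    obtain ⟨y, hyN, hy⟩ : ∃ y ∈ N, y ∉ x • (⊤ : Submodule R M) := by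
      by_contra! H
      have hle : N ≤ Ideal.span {x} • N := fun y hy ↦ by
        obtain ⟨z, -, rfl⟩ := (Submodule.mem_smul_pointwise_iff_exists _ _ _).mp (H y hy)
        refine Submodule.smul_mem_smul (Ideal.mem_span_singleton_self x) ?_
        rw [Submodule.mem_torsionBySet_iff] at hy ⊢
        intro r
        refine h.1.right_eq_zero_of_smul ?_
        rw [smul_comm]
        exact hy r
      have hN : N = ⊥ := Submodule.eq_bot_of_le_smul_of_le_jacobson_bot _ _
        (IsNoetherian.noetherian N) hle
        (((Ideal.span_singleton_le_iff_mem _).mpr hx).trans (maximalIdeal_le_jacobson _))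
      rw [hN] at hy₀N
      exact hy₀ne hy₀N
    -- The nonzero class of y in M/xM is killed by q and by x, so some associated prime of M/xM
    -- strictly contains q.
    have hyne : (Submodule.Quotient.mk y : QuotSMulTop x M) ≠ 0 := by
      rwa [Ne, Submodule.Quotient.mk_eq_zero]
    obtain ⟨q', hq', hle⟩ := exists_le_isAssociatedPrime_of_isNoetherianRing R _ hyne
    have hlt : q < (⟨q', hq'.isPrime⟩ : PrimeSpectrum R) := by
      refine lt_of_le_of_ne (fun r hr ↦ hle ?_) fun heq ↦ hxq ?_
      · rw [Submodule.mem_colon_singleton, ← Submodule.Quotient.mk_smul,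
          (Submodule.mem_torsionBySet_iff _ _).mp hyN ⟨r, hr⟩]
        simp
      · rw [heq]
        refine hle ?_
        rw [Submodule.mem_colon_singleton, ← Submodule.Quotient.mk_smul, Submodule.mem_bot,
          Submodule.Quotient.mk_eq_zero]
        exact Submodule.smul_mem_pointwise_smul _ _ ⊤ Submodule.mem_top
    have := ih (fun r hr ↦ hrs r (by simp [hr])) h.2 (q := ⟨q', hq'.isPrime⟩) hq'
    calc ((x :: rs).length : ℕ∞) = rs.length + 1 := by simp
      _ ≤ Order.coheight (⟨q', hq'.isPrime⟩ : PrimeSpectrum R) + 1 := by gcongr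
      _ ≤ Order.coheight q := Order.coheight_add_one_le hlt

/-- The grade of a prime `p` on a module is at least the depth minus `dim R/p`. -/
lemma exists_isWeaklyRegular_mem_prime {M : Type u} [AddCommGroup M] [Module R M]
    [Module.Finite R M] [Nontrivial M] {n : ℕ} (h : DepthGE R M n) (p : PrimeSpectrum R) :
    ∃ rs : List R, (∀ r ∈ rs, r ∈ p.asIdeal) ∧ IsWeaklyRegular M rs ∧
      (n : ℕ∞) ≤ rs.length + Order.coheight p := by
  induction n generalizing M with
  | zero => exact ⟨[], by simp⟩
  | succ n ih =>
    by_cases hreg : ∃ x ∈ p.asIdeal, IsSMulRegular M x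
    · obtain ⟨x, hxp, hx⟩ := hreg
      have hxm : x ∈ maximalIdeal R := le_maximalIdeal p.2.ne_top hxp
      have := nontrivial_quotSMulTop_of_mem_maximalIdeal M hxm
      have hq : DepthGE R (QuotSMulTop x M) n :=
        DepthGE.of_exact_right (LinearMap.lsmul R M x) (x • (⊤ : Submodule R M)).mkQ hx
          (Submodule.mkQ_surjective _) (LinearMap.exact_lsmul_mkQ_smul_top M x)
          (h.mono n.le_succ) h
      obtain ⟨rs, h1, h2, h3⟩ := ih hq
      refine ⟨x :: rs, by simpa using ⟨hxp, h1⟩, .cons hx h2, ?_⟩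
      push_cast [List.length_cons]
      rw [add_right_comm]
      gcongr
    · push Not at hreg
      obtain ⟨rs, hlen, hmem, hrs⟩ := depthGE_iff_exists_isWeaklyRegular.mp h
      -- Prime avoidance: p consists of zero divisors, so it lies in an associated prime q, and
      -- depth ≤ dim R/q ≤ dim R/p. The empty sequence then suffices.
      obtain ⟨q, hq, hpq⟩ : ∃ q ∈ associatedPrimes R M, p.asIdeal ≤ q := by
        refine (Ideal.subset_union_prime_finite (associatedPrimes.finite R M) (f := id) 0 0
          fun _ hq _ _ ↦ IsAssociatedPrime.isPrime hq).mp ?_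
        simp only [id]
        rw [biUnion_associatedPrimes_eq_compl_regular]
        exact fun x hx ↦ hreg x hx
      refine ⟨[], by simp, by simp, ?_⟩
      have h1 := length_le_coheight_of_isAssociatedPrime hmem hrs
        (q := ⟨q, IsAssociatedPrime.isPrime hq⟩) hq
      rw [hlen] at h1
      simpa using h1.trans (Order.coheight_anti (a := p) hpq)

end DepthLocalization

/-! ### Maximal Cohen–Macaulay modules and their localization -/

section MaximalCohenMacaulay

open IsLocalRing RingTheory.Sequence

variable {R : Type u} [CommRing R] [IsLocalRing R] [IsNoetherianRing R]

lemma IsLocalMaximalCohenMacaulay.nontrivial {N : Type u} [AddCommGroup N] [Module R N]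
    (h : IsLocalMaximalCohenMacaulay R N) : Nontrivial N := by
  by_contra hN
  rw [not_nontrivial_iff_subsingleton] at hN
  -- On the zero module, sequences of zeros of any length are weakly regular, whereas the dimension
  -- is finite.
  have htop : localDepth R N = ⊤ := by
    refine ENat.eq_top_iff_forall_ge.mpr fun n ↦ ?_
    refine le_trans ?_ (le_iSup _ ⟨List.replicate n (0 : R), ?_, ?_⟩)
    · simp
    · intro r hr
      rw [List.eq_of_mem_replicate hr]
      exact zero_mem _
    · rw [isWeaklyRegular_iff]
      intro i hi a b _
      obtain ⟨a, rfl⟩ := Submodule.Quotient.mk_surjective _ a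
      obtain ⟨b, rfl⟩ := Submodule.Quotient.mk_surjective _ b
      rw [Subsingleton.elim a b]
  have h1 := h.depth_eq
  rw [htop] at h1
  exact (ringKrullDim_lt_top (R := R)).ne h1.symm

lemma IsLocalMaximalCohenMacaulay.depthGE {N : Type u} [AddCommGroup N] [Module R N]
    (h : IsLocalMaximalCohenMacaulay R N) {d : ℕ} (hd : ringKrullDim R = d) : DepthGE R N d := by
  have := h.nontrivial
  have := h.finite
  rw [depthGE_iff_exists_isWeaklyRegular]
  have h1 : localDepth R N = d := WithBot.coe_injective (h.depth_eq.trans hd)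
  obtain ⟨⟨rs, hmem, hrs⟩, hlen⟩ : ∃ rs : {rs : List R // (∀ r ∈ rs, r ∈ maximalIdeal R) ∧
      IsWeaklyRegular N rs}, (rs.1.length : ℕ∞) = d := by
    have : Nonempty {rs : List R // (∀ r ∈ rs, r ∈ maximalIdeal R) ∧ IsWeaklyRegular N rs} :=
      ⟨⟨[], by simp⟩⟩
    rw [← h1]
    refine ENat.exists_eq_iSup_of_lt_top ?_
    change localDepth R N < ⊤
    rw [h1]
    exact ENat.natCast_lt_top d
  exact ⟨rs, by exact_mod_cast hlen, hmem, hrs⟩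

lemma DepthGE.isLocalMaximalCohenMacaulay {N : Type u} [AddCommGroup N] [Module R N]
    [Module.Finite R N] [Nontrivial N] {d : ℕ} (hd : ringKrullDim R = d) (h : DepthGE R N d) :
    IsLocalMaximalCohenMacaulay R N where
  finite := inferInstance
  depth_eq := by
    rw [hd]
    refine congrArg WithBot.some (le_antisymm (iSup_le fun ⟨rs, hmem, hrs⟩ ↦ ?_) ?_)
    · have h1 := (length_le_supportDim hmem hrs).trans (Module.supportDim_le_ringKrullDim R N)
      rw [hd] at h1
      exact WithBot.coe_le_coe.mp h1
    · obtain ⟨rs, hlen, hmem, hrs⟩ := depthGE_iff_exists_isWeaklyRegular.mp h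
      rw [← hlen]
      exact le_iSup (fun rs : {rs : List R // (∀ r ∈ rs, r ∈ maximalIdeal R) ∧
        IsWeaklyRegular N rs} ↦ (rs.1.length : ℕ∞)) ⟨rs, hmem, hrs⟩

/-- Maximal Cohen-Macaulay modules over a local ring localize. -/
lemma DepthGE.of_isBaseChange {R' : Type u} [CommRing R'] [IsLocalRing R'] [IsNoetherianRing R']
    [Algebra R R'] (p : Ideal R) [p.IsPrime] [IsLocalization.AtPrime R' p]
    {N N' : Type u} [AddCommGroup N] [Module R N] [Module.Finite R N] [Nontrivial N]
    [AddCommGroup N'] [Module R N'] [Module R' N'] [IsScalarTower R R' N'] [Module.Finite R' N']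
    [Nontrivial N'] {f : N →ₗ[R] N'} (hf : IsBaseChange R' f) {d d' : ℕ}
    (hd : ringKrullDim R = d) (hd' : ringKrullDim R' = d') (h : DepthGE R N d) :
    DepthGE R' N' d' := by
  obtain ⟨rs, hmem, hrs, hlen⟩ := exists_isWeaklyRegular_mem_prime h ⟨p, ‹_›⟩
  have : Module.Flat R R' := IsLocalization.flat R' p.primeCompl
  have hreg := hrs.of_flat_of_isBaseChange hf
  have hheight : Order.height (⟨p, ‹_›⟩ : PrimeSpectrum R) = (d' : ℕ∞) := by
    rw [← PrimeSpectrum.height_eq_orderHeight]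
    have := IsLocalization.AtPrime.ringKrullDim_eq_height p R'
    rw [hd'] at this
    exact (WithBot.coe_injective this).symm
  have hsum : (d' : ℕ∞) + Order.coheight (⟨p, ‹_›⟩ : PrimeSpectrum R) ≤ d := by
    have h1 := Order.krullDim_eq_iSup_height_add_coheight_of_nonempty (α := PrimeSpectrum R)
    rw [show Order.krullDim (PrimeSpectrum R) = (d : WithBot ℕ∞) from hd] at h1
    have h2 : (d : ℕ∞) = _ := WithBot.coe_injective h1
    rw [h2, ← hheight]
    exact le_iSup (fun a : PrimeSpectrum R ↦ Order.height a + Order.coheight a) ⟨p, ‹_›⟩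
  -- Combine ht p + dim R/p ≤ d with d ≤ length + dim R/p and cancel dim R/p, which is finite.
  have hle : d' ≤ rs.length := by
    have hfin : Order.coheight (⟨p, ‹_›⟩ : PrimeSpectrum R) ≠ ⊤ := fun htop ↦ by
      rw [htop] at hsum
      simp at hsum
    exact_mod_cast (ENat.add_le_add_iff_right hfin).mp (hsum.trans hlen)
  have hmem' : ∀ r ∈ rs.map (algebraMap R R'), r ∈ maximalIdeal R' := by
    intro r hr
    obtain ⟨x, hx, rfl⟩ := List.mem_map.mp hr
    exact (IsLocalization.AtPrime.to_map_mem_maximal_iff R' p x).mpr (hmem x hx)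
  exact DepthGE.mono (depthGE_iff_exists_isWeaklyRegular.mpr ⟨_, rfl, hmem', hreg⟩) (by simpa)

end MaximalCohenMacaulay

/-! ### From a maximal ideal to a smaller prime -/

section LocalizationTower

open IsLocalRing

lemma hasInjectiveDimensionLE_self_iff_of_ringEquiv {A B : Type u} [CommRing A] [CommRing B]
    (e : A ≃+* B) (n : ℕ) : HasInjectiveDimensionLE (ModuleCat.of A A) n ↔
      HasInjectiveDimensionLE (ModuleCat.of B B) n :=
  ModuleCat.hasInjectiveDimensionLE_iff_of_semiLinearEquiv e
    (M := ModuleCat.of A A) (N := ModuleCat.of B B) e.toSemilinearEquiv n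

lemma hasInjectiveDimensionLE_self_of_isLocalization {R : Type u} [CommRing R] [IsNoetherianRing R]
    (S : Submonoid R) (A : Type u) [CommRing A] [Algebra R A] [IsLocalization S A] (n : ℕ)
    [HasInjectiveDimensionLE (ModuleCat.of R R) n] :
    HasInjectiveDimensionLE (ModuleCat.of A A) n := by
  let M := ModuleCat.of R R
  have hM : HasInjectiveDimensionLE (M.localizedModule S) n :=
    ModuleCat.localizedModule_hasInjectiveDimensionLE n S M
  have hS : IsLocalizedModule S (M.localizedModuleMkLinearMap S) :=
    ModuleCat.localizedModule_isLocalizedModule M S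
  let e₁ : M.localizedModule S ≃ₗ[Localization S] ModuleCat.of (Localization S) (Localization S) :=
    (IsLocalizedModule.linearEquiv S (M.localizedModuleMkLinearMap S)
      (Algebra.linearMap R (Localization S))).extendScalarsOfIsLocalization S (Localization S)
  exact (hasInjectiveDimensionLE_self_iff_of_ringEquiv
    (IsLocalization.algEquiv S (Localization S) A).toRingEquiv n).mp
    ((ModuleCat.hasInjectiveDimensionLE_iff_of_linearEquiv e₁ n).mp hM)

lemma exists_ringKrullDim_eq_natCast (R : Type*) [CommRing R] [Nontrivial R]
    [FiniteRingKrullDim R] : ∃ d : ℕ, ringKrullDim R = d := by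
  obtain ⟨d, hd⟩ := WithBot.ne_bot_iff_exists.mp (ringKrullDim_ne_bot (R := R))
  have htop : d ≠ ⊤ := fun h ↦ ringKrullDim_ne_top (R := R) (by rw [← hd, h]; rfl)
  obtain ⟨n, rfl⟩ := ENat.ne_top_iff_exists.mp htop
  exact ⟨n, hd.symm⟩

variable {R : Type u} [CommRing R]

lemma exists_isLocalization_atPrime_of_le {P Q : Ideal R} [P.IsPrime] [Q.IsPrime] (h : P ≤ Q) :
    ∃ (_ : Algebra (Localization.AtPrime Q) (Localization.AtPrime P))
      (_ : IsScalarTower R (Localization.AtPrime Q) (Localization.AtPrime P))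
      (p : Ideal (Localization.AtPrime Q)) (_ : p.IsPrime),
      IsLocalization.AtPrime (Localization.AtPrime P) p := by
  have hle : Q.primeCompl ≤ P.primeCompl := fun x hx hxP ↦ hx (h hxP)
  let _ : Algebra (Localization.AtPrime Q) (Localization.AtPrime P) :=
    IsLocalization.localizationAlgebraOfSubmonoidLe _ _ Q.primeCompl P.primeCompl hle
  have htower : IsScalarTower R (Localization.AtPrime Q) (Localization.AtPrime P) :=
    IsLocalization.localization_isScalarTower_of_submonoid_le _ _ _ _ hle
  have hloc := IsLocalization.isLocalization_of_submonoid_le (Localization.AtPrime Q)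
    (Localization.AtPrime P) Q.primeCompl P.primeCompl hle
  let p := (maximalIdeal (Localization.AtPrime P)).comap
    (algebraMap (Localization.AtPrime Q) (Localization.AtPrime P))
  refine ⟨inferInstance, htower, p, inferInstance, ?_⟩
  -- R_P inverts the image of the complement of P in R_Q. Every element outside p has a multiple in
  -- that image, by clearing denominators.
  refine IsLocalization.isLocalization_of_is_exists_mul_mem _
    (P.primeCompl.map (algebraMap R (Localization.AtPrime Q))) _ ?_ ?_
  · rintro - ⟨x, hx, rfl⟩ hxp
    rw [SetLike.mem_coe, Ideal.mem_comap, ← IsScalarTower.algebraMap_apply,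
      IsLocalization.AtPrime.to_map_mem_maximal_iff _ P] at hxp
    exact hx hxp
  · rintro ⟨x, hx⟩
    obtain ⟨⟨a, s⟩, ha⟩ := IsLocalization.surj Q.primeCompl x
    refine ⟨algebraMap R _ s, a, fun haP ↦ hx ?_, by rw [← ha, mul_comm]⟩
    rw [SetLike.mem_coe, Ideal.mem_comap]
    have h1 : algebraMap R (Localization.AtPrime P) a ∈ maximalIdeal (Localization.AtPrime P) :=
      (IsLocalization.AtPrime.to_map_mem_maximal_iff _ P a).mpr haP
    have h2 := congrArg (algebraMap (Localization.AtPrime Q) (Localization.AtPrime P)) ha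
    rw [map_mul, ← IsScalarTower.algebraMap_apply, ← IsScalarTower.algebraMap_apply] at h2
    rw [← h2] at h1
    refine ((maximalIdeal.isMaximal _).isPrime.mem_or_mem h1).resolve_right fun h3 ↦ ?_
    exact hle s.2 ((IsLocalization.AtPrime.to_map_mem_maximal_iff _ P _).mp h3)

variable [IsNoetherianRing R]

lemma IsLocalMaximalCohenMacaulay.of_le {N : Type u} [AddCommGroup N] [Module R N]
    {P Q : Ideal R} [P.IsPrime] [Q.IsPrime] (h : P ≤ Q) [Nontrivial (LocalizedModule.AtPrime P N)]
    [Module.Finite R N]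
    (hN : IsLocalMaximalCohenMacaulay (Localization.AtPrime Q) (LocalizedModule.AtPrime Q N)) :
    IsLocalMaximalCohenMacaulay (Localization.AtPrime P) (LocalizedModule.AtPrime P N) := by
  obtain ⟨_, _, p, _, _⟩ := exists_isLocalization_atPrime_of_le h
  let _ : Module (Localization.AtPrime Q) (LocalizedModule.AtPrime P N) :=
    Module.compHom _ (algebraMap (Localization.AtPrime Q) (Localization.AtPrime P))
  have : IsScalarTower (Localization.AtPrime Q) (Localization.AtPrime P)
    (LocalizedModule.AtPrime P N) := .of_algebraMap_smul fun _ _ ↦ rfl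
  have : IsScalarTower R (Localization.AtPrime Q) (LocalizedModule.AtPrime P N) :=
    .to₁₂₄ R (Localization.AtPrime Q) (Localization.AtPrime P) (LocalizedModule.AtPrime P N)
  have hQ : IsBaseChange (Localization.AtPrime Q) (LocalizedModule.mkLinearMap Q.primeCompl N) :=
    IsLocalizedModule.isBaseChange Q.primeCompl _ _
  have hP : IsBaseChange (Localization.AtPrime P) (LocalizedModule.mkLinearMap P.primeCompl N) :=
    IsLocalizedModule.isBaseChange P.primeCompl _ _
  let g : LocalizedModule.AtPrime Q N →ₗ[Localization.AtPrime Q] LocalizedModule.AtPrime P N :=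
    hQ.lift (LocalizedModule.mkLinearMap P.primeCompl N)
  have hg : IsBaseChange (Localization.AtPrime P) g :=
    .of_comp hQ (by rwa [IsBaseChange.lift_comp])
  obtain ⟨d, hd⟩ := exists_ringKrullDim_eq_natCast (Localization.AtPrime Q)
  obtain ⟨d', hd'⟩ := exists_ringKrullDim_eq_natCast (Localization.AtPrime P)
  have := hN.finite
  have := hN.nontrivial
  have : Module.Finite (Localization.AtPrime P) (LocalizedModule.AtPrime P N) :=
    Module.Finite.of_isLocalizedModule P.primeCompl (LocalizedModule.mkLinearMap P.primeCompl N)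
  exact ((hN.depthGE hd).of_isBaseChange p hg hd hd').isLocalMaximalCohenMacaulay hd'

lemma injectiveDimension_lt_top_of_le {P Q : Ideal R} [P.IsPrime] [Q.IsPrime] (h : P ≤ Q)
    (hQ : injectiveDimension (ModuleCat.of (Localization.AtPrime Q) (Localization.AtPrime Q)) < ⊤) :
    injectiveDimension (ModuleCat.of (Localization.AtPrime P) (Localization.AtPrime P)) < ⊤ := by
  obtain ⟨_, _, p, _, _⟩ := exists_isLocalization_atPrime_of_le h
  obtain ⟨n, hn⟩ := (injectiveDimension_ne_top_iff _).mp hQ.ne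
  exact lt_top_iff_ne_top.mpr ((injectiveDimension_ne_top_iff _).mpr
    ⟨n, hasInjectiveDimensionLE_self_of_isLocalization p.primeCompl (Localization.AtPrime P) n⟩)

end LocalizationTower

/-! ### The trace form on the endomorphism ring -/

section TraceForm

/-- The trace of a matrix over a field that is integral over `R` is integral over `R`. -/
lemma Matrix.isIntegral_trace {R K ι : Type*} [CommRing R] [Field K] [Algebra R K] [Fintype ι]
    [DecidableEq ι] {N : Matrix ι ι K} (hN : IsIntegral R N) : IsIntegral R N.trace := by
  obtain ⟨p, hp, hpN⟩ := hN
  let L := AlgebraicClosure K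
  let N' : Matrix ι ι L := N.map (algebraMap K L)
  have hpN' : Polynomial.aeval N' p = 0 := by
    have h := congrArg ((Algebra.ofId K L).mapMatrix.restrictScalars R) hpN
    rw [map_zero] at h
    refine Eq.trans ?_ h
    exact (Polynomial.aeval_algHom_apply ((Algebra.ofId K L).mapMatrix.restrictScalars R) N p)
  rw [← isIntegral_algebraMap_iff (A := K) (B := L) (algebraMap K L).injective]
  have htr : algebraMap K L N.trace = N'.trace := AddMonoidHom.map_trace (algebraMap K L) N
  -- Over the algebraic closure the trace is the sum of the eigenvalues, each a root of the monic p
  -- that annihilates N.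
  rw [htr, Matrix.trace_eq_sum_roots_charpoly]
  refine IsIntegral.multiset_sum fun μ hμ ↦ ⟨p, hp, ?_⟩
  have hroot : (Matrix.toLin' N').charpoly.IsRoot μ := by
    rw [Matrix.charpoly_toLin']
    exact Polynomial.isRoot_of_mem_roots hμ
  obtain ⟨v, hv⟩ :=
    ((Module.End.hasEigenvalue_iff_isRoot_charpoly _ _).mpr hroot).exists_hasEigenvector
  have h := Module.End.aeval_apply_of_hasEigenvector (p := p.map (algebraMap R L)) hv
  rw [Polynomial.aeval_map_algebraMap] at h
  have h0 : Polynomial.aeval (Matrix.toLin' N') p = 0 := by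
    have := Polynomial.aeval_algHom_apply
      ((Matrix.toLinAlgEquiv' (R := L) (n := ι)).toAlgHom.restrictScalars R) N' p
    rw [hpN', map_zero] at this
    exact this
  rw [h0, LinearMap.zero_apply, Polynomial.eval_map] at h
  exact (smul_eq_zero.mp h.symm).resolve_right hv.2

/-- A finitely generated torsion-free module over a domain has a dual basis up to a nonzero
scalar. -/
lemma exists_smul_eq_sum_dual_smul (R M : Type*) [CommRing R] [IsDomain R] [AddCommGroup M]
    [Module R M] [Module.Finite R M] : ∃ (n : ℕ) (r : R) (f : Fin n → Module.Dual R M)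
      (m : Fin n → M), r ≠ 0 ∧ (∀ x, r • x = ∑ i, f i x • m i) ∧
      ∀ i j, f i (m j) = if i = j then r else 0 := by
  classical
  obtain ⟨k, v, hv⟩ := Module.Finite.exists_fin (R := R) (M := M)
  -- A maximal independent set of generators spans a free N, and the product r of one multiplier per
  -- generator carries M into N. The forms are coordinates after multiplication by r.
  obtain ⟨s, hs, hmax⟩ := exists_maximal_linearIndepOn R v
  let N := Submodule.span R (Set.range fun i : s ↦ v i)
  let b : Module.Basis s R N := Module.Basis.span hs
  have hb : ∀ i, (b i : M) = v i := fun i ↦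
    congrArg Subtype.val (Module.Basis.span_apply hs i)
  have hN : N = Submodule.span R (v '' s) := by rw [Set.image_eq_range]
  have hex : ∀ i, ∃ a : R, a ≠ 0 ∧ a • v i ∈ N := fun i ↦ by
    by_cases hi : i ∈ s
    · exact ⟨1, one_ne_zero, by
        rw [one_smul]; exact Submodule.subset_span ⟨⟨i, hi⟩, rfl⟩⟩
    · rw [hN]
      exact hmax i hi
  choose a ha haN using hex
  let r := ∏ i, a i
  have hr : r ≠ 0 := Finset.prod_ne_zero_iff.mpr fun i _ ↦ ha i
  have hrN : ∀ x : M, r • x ∈ N := by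
    have : (⊤ : Submodule R M) ≤ N.comap (LinearMap.lsmul R M r) := by
      rw [← hv, Submodule.span_le]
      rintro - ⟨i, rfl⟩
      change r • v i ∈ N
      rw [show r = (∏ j ∈ Finset.univ.erase i, a j) * a i from
        (Finset.prod_erase_mul _ _ (Finset.mem_univ i)).symm, mul_smul]
      exact N.smul_mem _ (haN i)
    exact fun x ↦ this (Submodule.mem_top (x := x))
  let g : M →ₗ[R] N := (LinearMap.lsmul R M r).codRestrict N hrN
  let e := Fintype.equivFin s
  refine ⟨Fintype.card s, r, fun i ↦ b.coord (e.symm i) ∘ₗ g, fun i ↦ v (e.symm i), hr,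
    fun x ↦ ?_, fun i j ↦ ?_⟩
  · have h := congrArg N.subtype (b.sum_repr (g x))
    rw [map_sum] at h
    have hg : N.subtype (g x) = r • x := rfl
    rw [hg] at h
    rw [← h, ← e.symm.sum_comp]
    refine Finset.sum_congr rfl fun i _ ↦ ?_
    simp [hb]
  · have hg : g (v (e.symm j)) = r • b (e.symm j) := Subtype.ext (by
      change r • v (e.symm j) = r • (b (e.symm j) : M)
      rw [hb])
    change b.coord (e.symm i) (g (v (e.symm j))) = _
    rw [hg]
    simp [Finsupp.single_apply, eq_comm]

/-- The trace form on the endomorphisms of a reflexive module over a normal domain. -/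
lemma exists_traceForm (R M : Type*) [CommRing R] [IsDomain R] [IsIntegrallyClosed R]
    [AddCommGroup M] [Module R M] [Module.IsReflexive R M] [Module.Finite R M]
    [Module.Finite R (Module.End R M)] : ∃ t : Module.End R M →ₗ[R] R,
      ∀ l : Module.End R M →ₗ[R] R, ∃! a, ∀ x, l x = t (a * x) := by
  classical
  obtain ⟨n, r, f, m, hr, hsum, hfm⟩ := exists_smul_eq_sum_dual_smul R M
  obtain ⟨K, _, _, _⟩ : ∃ (K : Type _) (_ : Field K) (_ : Algebra R K), IsFractionRing R K :=
    ⟨FractionRing R, inferInstance, inferInstance, inferInstance⟩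
  have hinj : Function.Injective (algebraMap R K) := IsFractionRing.injective R K
  have hrK : algebraMap R K r ≠ 0 := (map_ne_zero_iff _ hinj).mpr hr
  -- The matrix of φ on the generic fibre K ⊗ M, in the basis m_j with dual basis f_i / r.
  let G : Module.End R M →ₐ[R] Matrix (Fin n) (Fin n) K :=
    AlgHom.ofLinearMap
      { toFun := fun φ ↦ .of fun i j ↦ algebraMap R K (f i (φ (m j))) / algebraMap R K r
        map_add' := fun φ ψ ↦ by ext; simp [add_div]
        map_smul' := fun c φ ↦ by ext; simp [mul_div_assoc, Algebra.smul_def] }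
      (by
        ext i j
        change algebraMap R K (f i (m j)) / algebraMap R K r = _
        rw [hfm, Matrix.one_apply]
        split_ifs <;> simp [hrK])
      (fun φ ψ ↦ by
        ext i j
        change algebraMap R K (f i (φ (ψ (m j)))) / algebraMap R K r =
          ∑ k, algebraMap R K (f i (φ (m k))) / algebraMap R K r *
            (algebraMap R K (f k (ψ (m j))) / algebraMap R K r)
        have h := congrArg (fun x ↦ algebraMap R K (f i (φ x))) (hsum (ψ (m j)))
        simp only [map_smul, map_sum, smul_eq_mul, map_mul] at h
        rw [div_eq_iff hrK, Finset.sum_mul]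
        refine mul_left_cancel₀ hrK (h.trans ?_)
        rw [Finset.mul_sum]
        refine Finset.sum_congr rfl fun k _ ↦ ?_
        field_simp)
  -- Endomorphisms are integral over R, hence so are their traces, which lie in R by normality.
  have hmem : ∀ φ : Module.End R M, ∃ c : R, r * c = ∑ i, f i (φ (m i)) := fun φ ↦ by
    have hint : IsIntegral R (G φ).trace := Matrix.isIntegral_trace
      (((Algebra.IsIntegral.of_finite R (Module.End R M)).isIntegral φ).map G)
    obtain ⟨c, hc⟩ := IsIntegrallyClosed.isIntegral_iff.mp hint
    refine ⟨c, hinj ?_⟩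
    rw [map_mul, hc, map_sum]
    change _ * ∑ i, algebraMap R K (f i (φ (m i))) / algebraMap R K r = _
    rw [← Finset.sum_div, mul_div_cancel₀ _ hrK]
  choose τ hτ using hmem
  let t : Module.End R M →ₗ[R] R :=
    { toFun := τ
      map_add' := fun φ ψ ↦ mul_left_cancel₀ hr (by
        rw [mul_add, hτ, hτ, hτ, ← Finset.sum_add_distrib]; simp)
      map_smul' := fun c φ ↦ mul_left_cancel₀ hr (by
        simp [hτ, mul_left_comm r, Finset.mul_sum]) }
  -- The rank-one endomorphisms z ↦ g(z) y. They detect a through t(a ∘ E g y) = g(a y), and r times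
  -- any endomorphism is a sum of them.
  let E (g : Module.Dual R M) (y : M) : Module.End R M := g.smulRight y
  have ht : ∀ (a : Module.End R M) g y, t (a * E g y) = g (a y) := fun a g y ↦ by
    refine mul_left_cancel₀ hr ((hτ _).trans ?_)
    have h := congrArg g (hsum (a y))
    simp only [map_smul, map_sum, smul_eq_mul] at h
    rw [h]
    exact Finset.sum_congr rfl fun i _ ↦ by simp [E, mul_comm]
  have hE : ∀ x : Module.End R M, r • x = ∑ i, E (f i) (x (m i)) := fun x ↦ by
    ext y
    have h := congrArg x (hsum y)
    simp only [map_smul, map_sum] at h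
    simp [E, h]
  refine ⟨t, fun l ↦ ?_⟩
  -- The form l sends y to the functional g ↦ l(E g y) in M**; reflexivity turns this into an
  -- element a(y) of M.
  let L : M →ₗ[R] Module.Dual R (Module.Dual R M) := LinearMap.mk₂ R (fun y g ↦ l (E g y))
    (fun _ _ _ ↦ by rw [← map_add]; exact congrArg l (LinearMap.ext fun z ↦ smul_add _ _ _))
    (fun _ _ _ ↦ by rw [← map_smul]; exact congrArg l (LinearMap.ext fun z ↦ smul_comm _ _ _))
    (fun _ _ _ ↦ by rw [← map_add]; exact congrArg l (LinearMap.ext fun z ↦ add_smul _ _ _))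
    (fun _ _ _ ↦ by rw [← map_smul]; exact congrArg l (LinearMap.ext fun z ↦ mul_smul _ _ _))
  let a : Module.End R M := (Module.evalEquiv R M).symm.toLinearMap ∘ₗ L
  have ha : ∀ g y, g (a y) = l (E g y) := fun g y ↦ by
    simp [a, L]
  refine ⟨a, fun x ↦ ?_, fun a' ha' ↦ ?_⟩
  · refine mul_left_cancel₀ hr ?_
    rw [← smul_eq_mul, ← smul_eq_mul, ← map_smul, ← map_smul, ← mul_smul_comm, hE, Finset.mul_sum,
      map_sum, map_sum]
    exact Finset.sum_congr rfl fun i _ ↦ by rw [ht, ha]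
  · ext y
    refine (Module.bijective_dual_eval R M).injective (LinearMap.ext fun g ↦ ?_)
    change g (a' y) = g (a y)
    rw [ha, ha', ht]

/-- A reflexive module over a Noetherian domain with finitely generated endomorphism
ring is finitely generated. -/
lemma Module.IsReflexive.finite_of_finite_end (R M : Type*) [CommRing R] [IsDomain R]
    [IsNoetherianRing R] [AddCommGroup M] [Module R M] [Module.IsReflexive R M]
    [Module.Finite R (Module.End R M)] : Module.Finite R M := by
  rcases subsingleton_or_nontrivial M with _ | _
  · infer_instance
  obtain ⟨y, hy⟩ := exists_ne (0 : M)
  obtain ⟨g, hg⟩ : ∃ g : Module.Dual R M, g ≠ 0 := by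
    by_contra! H
    refine hy ((Module.bijective_dual_eval R M).injective (LinearMap.ext fun g ↦ ?_))
    rw [H g]
    simp
  obtain ⟨z, hz⟩ : ∃ z, g z ≠ 0 := by
    by_contra! H
    exact hg (LinearMap.ext H)
  -- The map y ↦ g(·) y embeds M in its endomorphism ring, since g(z) ≠ 0 and M is torsion-free.
  let j : M →ₗ[R] Module.End R M := LinearMap.smulRightₗ g
  refine Module.Finite.of_injective j fun x x' h ↦ ?_
  have := LinearMap.congr_fun h z
  exact smul_right_injective M hz (by simpa [j] using this)

/-- Perfect forms localize. -/
lemma existsUnique_form_of_isLocalizedModule {R Γ R' B : Type*} [CommRing R] [IsNoetherianRing R]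
    [CommRing R'] [Algebra R R'] (S : Submonoid R) [IsLocalization S R'] [Ring Γ] [Algebra R Γ]
    [Module.Finite R Γ] [Ring B] [Algebra R B] [Algebra R' B] [IsScalarTower R R' B]
    (φ : Γ →ₐ[R] B) [IsLocalizedModule S φ.toLinearMap] (t : Γ →ₗ[R] R)
    (ht : ∀ l : Γ →ₗ[R] R, ∃! g : Γ, ∀ x, l x = t (x * g)) : ∃ t' : B →ₗ[R'] R',
      ∀ l : B →ₗ[R'] R', ∃! g : B, ∀ x, l x = t' (x * g) := by
  have := Module.finitePresentation_of_finite R Γ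
  let Λ := IsLocalizedModule.mapExtendScalars S φ.toLinearMap (Algebra.linearMap R R') R'
  let t' := Λ t
  let Φ : Γ →ₗ[R] (Γ →ₗ[R] R) := (LinearMap.mul R Γ).flip.compr₂ t
  let Φ' : B →ₗ[R'] (B →ₗ[R'] R') := (LinearMap.mul R' B).flip.compr₂ t'
  have hΛ : ∀ l x, Λ l (φ x) = algebraMap R R' (l x) := fun l x ↦
    IsLocalizedModule.map_apply S φ.toLinearMap (Algebra.linearMap R R') l x
  have hΦ : Function.Bijective Φ := by
    refine Function.bijective_iff_existsUnique _ |>.mpr fun l ↦ ?_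
    obtain ⟨g, hg, hu⟩ := ht l
    exact ⟨g, LinearMap.ext fun x ↦ (hg x).symm, fun g' h ↦ hu g' fun x ↦ by rw [← h]; rfl⟩
  -- As Γ is finitely presented, Λ exhibits Hom(B, R') as the localization of Hom(Γ, R). So Φ' is
  -- the localization of the bijection Φ.
  have hmap : IsLocalizedModule.map S φ.toLinearMap Λ Φ = Φ'.restrictScalars R := by
    refine IsLocalizedModule.ext S φ.toLinearMap (IsLocalizedModule.map_units Λ) ?_
    ext g : 1
    have h1 : IsLocalizedModule.map S φ.toLinearMap Λ Φ (φ g) = Λ (Φ g) :=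
      IsLocalizedModule.map_apply S φ.toLinearMap Λ Φ g
    refine h1.trans (LinearMap.restrictScalars_injective R ?_)
    refine IsLocalizedModule.ext S φ.toLinearMap
      (IsLocalizedModule.map_units (Algebra.linearMap R R')) ?_
    ext x
    change Λ (Φ g) (φ x) = Λ t (φ x * φ g)
    rw [← map_mul, hΛ, hΛ]
    rfl
  have hΦ' : Function.Bijective Φ' := by
    have h1 := IsLocalizedModule.map_injective S φ.toLinearMap Λ Φ hΦ.1
    have h2 := IsLocalizedModule.map_surjective S φ.toLinearMap Λ Φ hΦ.2
    rw [hmap] at h1 h2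
    exact ⟨h1, h2⟩
  refine ⟨t', fun l ↦ ?_⟩
  obtain ⟨g, hg, hu⟩ := Function.bijective_iff_existsUnique _ |>.mp hΦ' l
  exact ⟨g, fun x ↦ by rw [← hg]; rfl, fun g' h ↦ hu g' (LinearMap.ext fun x ↦ (h x).symm)⟩

end TraceForm

/-! ### Localized algebras and their opposites -/

section Localization

open IsLocalRing RingTheory.Sequence

/-- The localization of an algebra is an algebra over the localized ring. -/
instance LocalizedModule.algebraLocalization {R A : Type*} [CommRing R] [Ring A] [Algebra R A]
    (S : Submonoid R) : Algebra (Localization S) (LocalizedModule S A) :=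
  Algebra.ofModule
    (fun r x y ↦ by
      induction x using LocalizedModule.induction_on with | _ a s
      induction y using LocalizedModule.induction_on with | _ b t
      induction r using Localization.induction_on with | _ c
      rw [LocalizedModule.mk_smul_mk, LocalizedModule.mk_mul_mk, LocalizedModule.mk_mul_mk,
        LocalizedModule.mk_smul_mk, smul_mul_assoc, mul_assoc])
    (fun r x y ↦ by
      induction x using LocalizedModule.induction_on with | _ a s
      induction y using LocalizedModule.induction_on with | _ b t
      induction r using Localization.induction_on with | _ c
      rw [LocalizedModule.mk_smul_mk, LocalizedModule.mk_mul_mk, LocalizedModule.mk_mul_mk,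
        LocalizedModule.mk_smul_mk, mul_smul_comm, mul_left_comm])

/-- The localization map of the opposite of an algebra. -/
noncomputable def LocalizedModule.mkOpAlgHom {R : Type*} (A : Type*) [CommRing R] [Ring A]
    [Algebra R A]
    (S : Submonoid R) : Aᵐᵒᵖ →ₐ[R] (LocalizedModule S A)ᵐᵒᵖ :=
  AlgHom.op { LocalizedModule.numeratorRingHom (S := S) (A := A) with commutes' := fun _ ↦ rfl }

instance LocalizedModule.isLocalizedModule_mkOpAlgHom {R A : Type*} [CommRing R] [Ring A]
    [Algebra R A] (S : Submonoid R) :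
    IsLocalizedModule S (LocalizedModule.mkOpAlgHom A S).toLinearMap := by
  have h1 := IsLocalizedModule.of_linearEquiv_right S (LocalizedModule.mkLinearMap S A)
    (MulOpposite.opLinearEquiv R (M := A)).symm
  exact IsLocalizedModule.of_linearEquiv S (LocalizedModule.mkLinearMap S A ∘ₗ
    ((MulOpposite.opLinearEquiv R (M := A)).symm : Aᵐᵒᵖ →ₗ[R] A))
    (MulOpposite.opLinearEquiv R (M := LocalizedModule S A))

lemma DepthGE.of_linearEquiv {R : Type u} [CommRing R] [IsLocalRing R] [IsNoetherianRing R]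
    {N N' : Type u} [AddCommGroup N] [Module R N] [Module.Finite R N] [Nontrivial N]
    [AddCommGroup N'] [Module R N'] (e : N ≃ₗ[R] N') {n : ℕ} (h : DepthGE R N n) :
    DepthGE R N' n := by
  have : Module.Finite R N' := .equiv e
  have : Nontrivial N' := e.symm.toEquiv.nontrivial
  obtain ⟨rs, hlen, hmem, hrs⟩ := depthGE_iff_exists_isWeaklyRegular.mp h
  exact depthGE_iff_exists_isWeaklyRegular.mpr
    ⟨rs, hlen, hmem, (LinearEquiv.isWeaklyRegular_congr e rs).mp hrs⟩

lemma nontrivial_localizedModule_of_isTorsionFree {R N : Type*} [CommRing R] [IsDomain R]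
    [AddCommGroup N] [Module R N] [Module.IsTorsionFree R N] [Nontrivial N] (P : Ideal R)
    [P.IsPrime] : Nontrivial (LocalizedModule.AtPrime P N) := by
  obtain ⟨y, hy⟩ := exists_ne (0 : N)
  refine ⟨LocalizedModule.mkLinearMap P.primeCompl N y, 0, fun h ↦ ?_⟩
  obtain ⟨u, hu⟩ := (IsLocalizedModule.eq_zero_iff P.primeCompl _).mp h
  have hu0 : (u : R) ≠ 0 := fun h0 ↦ u.2 (by rw [h0]; exact zero_mem P)
  exact hy ((smul_eq_zero_iff_right hu0).mp hu)

end Localization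

/-! ### The theorem -/

lemma exists_forall_hasProjectiveDimensionLT {A : Type u} [Ring A]
    (h : rightGlobalDimension A < ⊤) :
    ∃ n, ∀ N : ModuleCat.{u} Aᵐᵒᵖ, HasProjectiveDimensionLT N (n + 1) := by
  obtain ⟨n, hn⟩ : ∃ n : ℕ, rightGlobalDimension A ≤ n := by
    generalize rightGlobalDimension A = d at h
    induction d with
    | bot => exact ⟨0, bot_le⟩
    | coe d =>
      induction d with
      | top => exact absurd h (lt_irrefl _)
      | coe d => exact ⟨d, le_rfl⟩
  exact ⟨n, fun N ↦ (projectiveDimension_le_iff N n).mp ((le_iSup _ N).trans hn)⟩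

lemma nontrivial_of_isMaximalCohenMacaulay {R : Type u} {N : Type u} [CommRing R] [Nontrivial R]
    [IsNoetherianRing R] [AddCommGroup N] [Module R N] (h : IsMaximalCohenMacaulay R N) :
    Nontrivial N := by
  obtain ⟨Q, hQ⟩ := Ideal.exists_maximal R
  have := (h.localization Q).nontrivial
  by_contra hN
  rw [not_nontrivial_iff_subsingleton] at hN
  exact not_subsingleton (LocalizedModule.AtPrime Q N) inferInstance

/-- The endomorphism ring of a reflexive module over a normal Gorenstein domain is homologically
homogeneous if it is maximal Cohen-Macaulay of finite global dimension. -/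
theorem isHomologicallyHomogeneous_end {R : Type u} [CommRing R] [IsDomain R]
    [IsIntegrallyClosed R] (hR : IsGorensteinRing R)
    {M : Type u} [AddCommGroup M] [Module R M] [Module.IsReflexive R M]
    (hgl : rightGlobalDimension (Module.End R M) < ⊤)
    (hCM : IsMaximalCohenMacaulay R (Module.End R M)) :
    IsHomologicallyHomogeneous R (Module.End R M) := by
  have := hR.noetherian
  have := hCM.finite
  have := nontrivial_of_isMaximalCohenMacaulay hCM
  have : Module.Finite R M := Module.IsReflexive.finite_of_finite_end R M
  have hcm (P : Ideal R) [P.IsPrime] : IsLocalMaximalCohenMacaulay (Localization.AtPrime P)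
      (LocalizedModule.AtPrime P (Module.End R M)) := by
    obtain ⟨Q, hQ, hPQ⟩ := P.exists_le_maximal Ideal.IsPrime.ne_top'
    have := nontrivial_localizedModule_of_isTorsionFree (N := Module.End R M) P
    exact (hCM.localization Q).of_le hPQ
  refine ⟨inferInstance, inferInstance, fun P _ ↦ ?_, fun P _ ↦ hcm P⟩
  obtain ⟨Q, hQ, hPQ⟩ := P.exists_le_maximal Ideal.IsPrime.ne_top'
  have hinj := injectiveDimension_lt_top_of_le hPQ (hR.injectiveDimension_lt_top Q)
  obtain ⟨d, hd⟩ := exists_ringKrullDim_eq_natCast (Localization.AtPrime P)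
  obtain ⟨n, hn⟩ := exists_forall_hasProjectiveDimensionLT hgl
  obtain ⟨t, ht⟩ := exists_traceForm R M
  let A := Module.End R M
  let φ := LocalizedModule.mkOpAlgHom A P.primeCompl
  -- Right modules are modules over the opposite ring, where t(ax) becomes t(x * a), the order of
  -- factors needed for the local theorem.
  obtain ⟨t', ht'⟩ := existsUnique_form_of_isLocalizedModule (R' := Localization.AtPrime P)
    P.primeCompl φ (t ∘ₗ (MulOpposite.opLinearEquiv R).symm.toLinearMap) fun l ↦ by
      obtain ⟨a, ha, hu⟩ := ht (l ∘ₗ (MulOpposite.opLinearEquiv R).toLinearMap)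
      exact ⟨.op a, fun x ↦ ha x.unop, fun a' ha' ↦
        MulOpposite.unop_injective (hu a'.unop fun x ↦ ha' (.op x))⟩
  have := (hcm P).finite
  have := (hcm P).nontrivial
  have hdepth := ((hcm P).depthGE hd).of_linearEquiv
    (MulOpposite.opLinearEquiv (Localization.AtPrime P))
  have : Module.Finite (Localization.AtPrime P) (LocalizedModule.AtPrime P A)ᵐᵒᵖ :=
    .equiv (MulOpposite.opLinearEquiv (Localization.AtPrime P))
  rw [hd]
  exact iSup_projectiveDimension_eq hinj hd t' ht' hdepth
    fun N ↦ forall_hasProjectiveDimensionLT_of_isLocalizedModule P.primeCompl φ hn N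

theorem lemma4p2 {R : Type u} [CommRing R] [IsDomain R] [IsIntegrallyClosed R]
    (hR : IsGorensteinRing R)
    {M : Type u} [AddCommGroup M] [Module R M] [Module.IsReflexive R M]
    (hgl : rightGlobalDimension (Module.End R M) < ⊤)
    (hCM : IsMaximalCohenMacaulay R (Module.End R M)) :
    IsHomologicallyHomogeneous R (Module.End R M) ∧
      IsNoncommutativeCrepantResolution R (Module.End R M) := by
  have h := isHomologicallyHomogeneous_end hR hgl hCM
  exact ⟨h, h, M, inferInstance, inferInstance, inferInstance, ⟨AlgEquiv.refl⟩⟩
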